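/- **Setting.** Let $N\ge 1$ and $m\ge 0$ be integers, $A_i\in\mathbb R^{m\times d_i}$, $b\in\mathbb R^m$, and let $f_i:\mathbb R^{d_i}\to\mathbb R\cup\{+\infty\}$, $i=1,\dots,N$, be closed, proper, with an affine minorant and with compact (possibly nonconvex) domain $\operatorname{dom} f_i$. Consider the problem of minimizing $\frac1N\sum_i f_i(x_i)$ subject to $\frac1N\sum_i A_ix_i\le b$, $x_i\in\operatorname{dom} f_i$. Put $X_i=\operatorname{conv}(\operatorname{dom} f_i)$ and $$d(\lambda)=-\lambda^\top b+\frac1N\sum_{i=1}^N\inf_{x\in X_i}\{f_i^{**}(x)+\lambda^\top A_ix\},$$ $$\gamma(f_i)=\sup_{\operatorname{dom} f_i} f_i-\inf_{\operatorname{dom} f_i} f_i\in[0,+\infty],\quad \tilde G=\sup_{i,\,x\in X_i}\|A_ix-b\|,\quad H=\sup_{i,\,x\in X_i}|f_i^{**}(x)|<\infty .$$ Assume that some $\lambda^*\in\mathbb R^m_+$ maximizes $d$ over $\mathbb R^m_+$ and that $d^*=d(\lambda^*)$ is also the optimal value of the bidual problem of minimizing $\frac1N\sum_i f_i^{**}(x_i)$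 subject to $\frac1N\sum_iA_ix_i\le b$, $x_i\in X_i$. Let an oracle return, for every $i$, $\gamma\ge0$ and $\lambda\in\mathbb R^m$, a point $x_i^*(\gamma,\lambda)\in\operatorname{dom} f_i$ that minimizes $\gamma f_i^{**}(x)+\lambda^\top A_ix$ over $X_i$ and at which $f_i=f_i^{**}$; write $x_i^*(\lambda)=x_i^*(1,\lambda)$. Let $T,K\ge1$, $\Lambda>0$, $\alpha=\Lambda/(\tilde G\sqrt T)$ (any value, e.g. $0$, if $\tilde G=0$), and let $[\cdot]_+$ be the componentwise positive part. **Stage 1.** Start at $\lambda_0=0$. For $t=0,\dots,T-2$ draw $i_t$ uniformly from $\{1,\dots,N\}$ and set $\lambda_{t+1}=[\lambda_t+\alpha(A_{i_t}x^*_{i_t}(\lambda_t)-b)]_+$. Let $\bar\lambda_T=\frac1T\sum_{t=0}^{T-1}\lambda_t$ and let $I_i$ be the number of $t\le T-2$ with $i_t=i$. **Stage 2.** Start from blocks $(\beta_i^0,z_i^0)$, $i=1,\dots,N$. For $k=0,\dots,K-1$, with $\beta^k=\sum_i\beta_i^k$ and $z^k=\sum_iz_i^k$, draw $i=i_k$ uniformly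 from $\{1,\dots,N\}$, call the oracle for block $i$ at $\gamma^k=\max(\beta^k-d(\bar\lambda_T),0)$, $g^k=[z^k-b]_+$ to get $x_i^{k+1}$, set $\rho_k=\frac{2N}{k+2N}$ and $$(\beta_i^{k+1},z_i^{k+1})=(1-\rho_k)(\beta_i^k,z_i^k)+\rho_k\tfrac1N(f_i(x_i^{k+1}),A_ix_i^{k+1}),$$ all other blocks being unchanged. All draws are independent. The starting blocks are either (i) *averaged*: $(\beta_i^0,z_i^0)$ is the average of the $I_i+1$ vectors $\frac1N\big(f_i(x),A_ix\big)$ for the stage 1 oracle outputs $x=x_i^*(\lambda_{T-1})$ and $x=x_i^*(\lambda_t)$, $t\le T-2$, $i_t=i$; or (ii) *at given points*: $(\beta_i^0,z_i^0)=\frac1N(f_i(x_i^0),A_ix_i^0)$ for given $x_i^0\in\operatorname{dom} f_i$ with $f_i(x_i^0)=f_i^{**}(x_i^0)$. **Reconstruction.** Let $(x_i^l)_{l\in Q_i}$ be the atoms of block $i$: the points used in its starting block (the $I_i+1$ oracle outputs in case (i), the point $x_i^0$ in case (ii)) and the points $x_i^{k+1}$ with $i_k=i$. Take any Carathéodory decomposition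 $$\binom{\beta^K}{z^K}=\sum_{i\in S}\sum_{l\in Q_i}\tilde\omega_i^l\,\frac1N\binom{f_i(x_i^l)}{A_ix_i^l}+\sum_{i\notin S}\frac1N\binom{f_i(x_i^{l_i})}{A_ix_i^{l_i}},\qquad |S|\le m+1,\ \tilde\omega_i^l\ge0,\ \sum_{l\in Q_i}\tilde\omega_i^l=1,\ l_i\in Q_i .$$ Independently for each $i\in S$ draw $\tilde l_i\in Q_i$ with probability $\tilde\omega_i^{\tilde l_i}$ and set $\bar x_i=x_i^{\tilde l_i}$; for $i\notin S$ set $\bar x_i=x_i^{l_i}$. **Theorem.** In case (i), the expectation over all the random draws satisfies $$\mathbb E\Big[\frac1N\sum_{i=1}^Nf_i(\bar x_i)-d^*\Big]\le\frac{m+1}N\max_i\gamma(f_i)+C\Big(\frac1{\sqrt T}+\frac1{\sqrt K}+\frac NK\Big(\sqrt{\frac NT}+\frac NT\Big)\Big),$$ $$\mathbb E\Big[\frac1N\sum_{i=1}^NA_i\bar x_i-b\Big]_j\le C\Big(\frac1{\sqrt T}+\frac1{\sqrt K}+\frac NK\Big(\sqrt{\frac NT}+\frac NT\Big)\Big),\qquad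 j=1,\dots,m,$$ where $C$ depends only on $\Lambda$ and on upper bounds for $\tilde G$, $H$ and $\|\lambda^*\|$ (in particular not on $N$, $m$, $T$, $K$). In case (ii) the same two bounds hold with a constant $C$ that may depend on $N$ as well. -/

import Mathlib

open scoped BigOperators

namespace TwoStage

noncomputable section

/-- `ℝⁿ` with the Euclidean norm. -/
abbrev E (n : ℕ) := EuclideanSpace ℝ (Fin n)

/-! ### Extended-valued functions -/

/-- The effective domain of an extended-valued function. -/
def dom {n : ℕ} (f : E n → EReal) : Set (E n) := {x | f x < ⊤}

/-- The Fenchel conjugate `f^*(y) = sup_{x ∈ dom f} (⟨y, x⟩ - f x)`. -/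
def conj {n : ℕ} (f : E n → EReal) (y : E n) : EReal :=
  ⨆ x ∈ dom f, (((inner ℝ y x : ℝ) : EReal) - f x)

/-- The biconjugate `f^{**}`. -/
def biconj {n : ℕ} (f : E n → EReal) : E n → EReal := conj (conj f)

/-- Closed and proper, with an affine minorant and a compact domain; no convexity. -/
structure IsAdmissible {n : ℕ} (f : E n → EReal) : Prop where
  closed : LowerSemicontinuous f
  ne_bot : ∀ x, f x ≠ ⊥
  dom_nonempty : (dom f).Nonempty
  affine_minorant : ∃ (a : E n) (c : ℝ), ∀ x, ((inner ℝ a x + c : ℝ) : EReal) ≤ f x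
  compact_dom : IsCompact (dom f)

/-- The nonconvexity measure `γ(f) = sup_{dom f} f - inf_{dom f} f`, with values in the extended
reals (it is `⊤` when `f` is unbounded above on its domain). -/
def gam {n : ℕ} (f : E n → EReal) : EReal := (⨆ x ∈ dom f, f x) - ⨅ x ∈ dom f, f x

/-- Projection onto the nonnegative orthant. -/
def projPos {m : ℕ} (v : E m) : E m := WithLp.toLp 2 (fun j => max (v j) 0)

/-! ### The separable problem -/

/-- Data of the problem: minimize `(1/N) ∑ f_i(x_i)` subject to `(1/N) ∑ A_i x_i ≤ b`,
`x_i ∈ dom f_i`. -/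
structure Problem (N m : ℕ) (d : Fin N → ℕ) where
  f : ∀ i, E (d i) → EReal
  A : ∀ i, Matrix (Fin m) (Fin (d i)) ℝ
  b : E m

namespace Problem

variable {N m : ℕ} {d : Fin N → ℕ} (P : Problem N m d)

/-- `A_i x`. -/
def act (i : Fin N) (x : E (d i)) : E m := Matrix.toEuclideanLin (P.A i) x

/-- The real value `f_i(x)`, used only at points of `dom f_i`. -/
def val (i : Fin N) (x : E (d i)) : ℝ := (P.f i x).toReal

/-- `X_i = conv(dom f_i)`, the domain of `f_i^{**}`. -/
def X (i : Fin N) : Set (E (d i)) := convexHull ℝ (dom (P.f i))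

/-- The real value `h_i(x) = f_i^{**}(x)`, used only at points of `X_i`. -/
def h (i : Fin N) (x : E (d i)) : ℝ := (biconj (P.f i) x).toReal

/-- The dual function
`d(λ) = -⟨λ, b⟩ + (1/N) ∑ inf_{x ∈ X_i} (f_i^{**}(x) + ⟨λ, A_i x⟩)`. -/
def dual (lam : E m) : ℝ :=
  -(inner ℝ lam P.b) +
    (1 / (N : ℝ)) * ∑ i, sInf ((fun x => P.h i x + inner ℝ lam (P.act i x)) '' P.X i)

/-- Feasibility for the bidual problem. -/
def BidualFeasible (x : ∀ i, E (d i)) : Prop :=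
  (∀ i, x i ∈ P.X i) ∧ ∀ j, ((1 / (N : ℝ)) • ∑ i, P.act i (x i)) j ≤ P.b j

/-- `lamStar` solves the dual problem, and strong duality holds: `d(lamStar)` is the optimal
value of the bidual problem. -/
structure IsDualSolution (lamStar : E m) : Prop where
  nonneg : ∀ j, 0 ≤ lamStar j
  isMax : ∀ lam : E m, (∀ j, 0 ≤ lam j) → P.dual lam ≤ P.dual lamStar
  strong_duality :
    IsGLB {v : ℝ | ∃ x, P.BidualFeasible x ∧ v = (1 / (N : ℝ)) * ∑ i, P.h i (x i)}
      (P.dual lamStar)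

/-- The minimization oracle of the bidual problem, returning for `γ ≥ 0` and `λ` a minimizer of
`γ f_i^{**} + ⟨λ, A_i ·⟩` over `conv(dom f_i)` which lies in `dom f_i` and at which `f_i` and
`f_i^{**}` agree. -/
structure IsOracle (orc : ∀ i, ℝ → E m → E (d i)) : Prop where
  mem_dom : ∀ i (g : ℝ) (lam : E m), 0 ≤ g → orc i g lam ∈ dom (P.f i)
  matches_biconj : ∀ i (g : ℝ) (lam : E m), 0 ≤ g →
    P.f i (orc i g lam) = biconj (P.f i) (orc i g lam)
  minimizes : ∀ i (g : ℝ) (lam : E m), 0 ≤ g → ∀ y ∈ P.X i,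
    g * P.h i (orc i g lam) + inner ℝ lam (P.act i (orc i g lam)) ≤
      g * P.h i y + inner ℝ lam (P.act i y)

/-- `G̃ = sup_{i, x ∈ X_i} ‖A_i x - b‖`. -/
def Gtilde : ℝ := sSup {r : ℝ | ∃ i, ∃ x ∈ P.X i, r = ‖P.act i x - P.b‖}

variable (orc : ∀ i, ℝ → E m → E (d i))

/-! ### Stage 1: stochastic dual subgradient -/

/-- The dual iterates `λ_t` (`t ≤ T`) for the sampled indices `i_0, …, i_{T-2}`; the last step,
`t = T - 1`, is deterministic. -/
def dualIter (lam0 : E m) (α : ℕ → ℝ) {T : ℕ} (ω : Fin (T - 1) → Fin N) : ℕ → E m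
  | 0 => lam0
  | t + 1 =>
    let lam := dualIter lam0 α ω t
    if ht : t < T - 1 then
      projPos (lam + α t • (P.act (ω ⟨t, ht⟩) (orc (ω ⟨t, ht⟩) 1 lam) - P.b))
    else
      projPos (lam + α t • ((1 / (N : ℝ)) • ∑ i, P.act i (orc i 1 lam) - P.b))

/-- The averaged dual output `λ̄_T = (1/T) ∑_{t < T} λ_t`. -/
def lamBar (lam0 : E m) (α : ℕ → ℝ) {T : ℕ} (ω : Fin (T - 1) → Fin N) : E m :=
  (1 / (T : ℝ)) • ∑ t ∈ Finset.range T, P.dualIter orc lam0 α ω t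

/-! ### Stage 2: block-coordinate Frank-Wolfe -/

/-- A starting point of the second stage, block `i` being the combination of the atoms
`pt i l`, `l ∈ Q i`, with weights `wt i l`. -/
structure Start (d : Fin N → ℕ) (ι : Type) where
  Q : Fin N → Finset ι
  wt : Fin N → ι → ℝ
  pt : ∀ i, ι → E (d i)

/-- `β_i^0 = ∑_{l ∈ Q_i} wt_i^l (1/N) f_i(x_i^l)`. -/
def beta0 {ι : Type} (s : Start d ι) (i : Fin N) : ℝ :=
  ∑ l ∈ s.Q i, s.wt i l * (1 / (N : ℝ) * P.val i (s.pt i l))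

/-- `z_i^0 = ∑_{l ∈ Q_i} wt_i^l (1/N) A_i x_i^l`. -/
def z0 {ι : Type} (s : Start d ι) (i : Fin N) : E m :=
  ∑ l ∈ s.Q i, s.wt i l • ((1 / (N : ℝ)) • P.act i (s.pt i l))

/-- The initialization by averaging, for each block, the `I_i + 1` oracle outputs of stage 1:
the output `x_i^*(λ_{T-1})` of the last step (index `none`) and the outputs `x_i^*(λ_t)` of the
steps `t ≤ T - 2` with `i_t = i` (index `some t`). -/
def averagedStart (lam0 : E m) (α : ℕ → ℝ) {T : ℕ} (ω : Fin (T - 1) → Fin N) :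
    Start d (Option (Fin (T - 1))) where
  Q i := Finset.univ.filter (fun l => ∀ t ∈ l, ω t = i)
  wt i _ := 1 / (((Finset.univ.filter (fun t => ω t = i)).card : ℝ) + 1)
  pt i
    | none => orc i 1 (P.dualIter orc lam0 α ω (T - 1))
    | some t => orc i 1 (P.dualIter orc lam0 α ω t)

/-- The initialization at one given point `x_i^0` per block. -/
def pointStart (x0 : ∀ i, E (d i)) : Start d Unit where
  Q _ := Finset.univ
  wt _ _ := 1
  pt i _ := x0 i

/-- The point returned by the oracle for block `i` at the blocks `(β_i, z_i)_i`, called with the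
gradient `(max(β - dbar, 0), max(z - b, 0))`, where `β = ∑ β_i`, `z = ∑ z_i`. -/
def fwPoint (dbar : ℝ) (s : (Fin N → ℝ) × (Fin N → E m)) (i : Fin N) : E (d i) :=
  orc i (max (∑ j, s.1 j - dbar) 0) (projPos (∑ j, s.2 j - P.b))

/-- The blocks `(β_i^k, z_i^k)_i` after `k ≤ K` iterations, for the sampled indices
`i_0, …, i_{K-1}` and stepsizes `ρ`. (At the oracle outputs `f_i = f_i^{**}`.) -/
def bcfw (dbar : ℝ) (ρ : ℕ → ℝ) {K : ℕ} (ω : Fin K → Fin N)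
    (s0 : (Fin N → ℝ) × (Fin N → E m)) : ℕ → (Fin N → ℝ) × (Fin N → E m)
  | 0 => s0
  | k + 1 =>
    let s := bcfw dbar ρ ω s0 k
    if hk : k < K then
      let i := ω ⟨k, hk⟩
      let x := P.fwPoint orc dbar s i
      (Function.update s.1 i ((1 - ρ k) * s.1 i + ρ k * (1 / (N : ℝ) * P.val i x)),
        Function.update s.2 i ((1 - ρ k) • s.2 i + ρ k • ((1 / (N : ℝ)) • P.act i x)))
    else s

/-- All blocks after `k` iterations of the second stage, from the starting point `s`. -/
def blocks {ι : Type} (dbar : ℝ) (ρ : ℕ → ℝ) {K : ℕ} (ω : Fin K → Fin N) (s : Start d ι)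
    (k : ℕ) : (Fin N → ℝ) × (Fin N → E m) :=
  P.bcfw orc dbar ρ ω (P.beta0 s, P.z0 s) k

/-- `β^K = ∑ β_i^K`. -/
def betaK {ι : Type} (dbar : ℝ) (ρ : ℕ → ℝ) {K : ℕ} (ω : Fin K → Fin N) (s : Start d ι) : ℝ :=
  ∑ i, (P.blocks orc dbar ρ ω s K).1 i

/-- `z^K = ∑ z_i^K`. -/
def zK {ι : Type} (dbar : ℝ) (ρ : ℕ → ℝ) {K : ℕ} (ω : Fin K → Fin N) (s : Start d ι) : E m :=
  ∑ i, (P.blocks orc dbar ρ ω s K).2 i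

/-- The index set `Q_i` of the atoms of block `i` after stage 2: the atoms of the starting point,
and one atom for each iteration `k` with `i_k = i`. -/
def atomIdx {ι : Type} {K : ℕ} (ω : Fin K → Fin N) (s : Start d ι) (i : Fin N) :
    Finset (ι ⊕ Fin K) :=
  (s.Q i).disjSum (Finset.univ.filter (fun k => ω k = i))

/-- The atoms `x_i^l`. -/
def atom {ι : Type} (dbar : ℝ) (ρ : ℕ → ℝ) {K : ℕ} (ω : Fin K → Fin N) (s : Start d ι)
    (i : Fin N) : ι ⊕ Fin K → E (d i)
  | Sum.inl l => s.pt i l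
  | Sum.inr k => P.fwPoint orc dbar (P.blocks orc dbar ρ ω s k) i

/-! ### Carathéodory decomposition and reconstruction -/

/-- An output of the Carathéodory step for `(β, z)` and atoms `x_i^l`, `l ∈ Q_i`: a set `S` with
at most `m + 1` indices, probability weights on `Q_i` for `i ∈ S`, one atom for each `i ∉ S`. -/
structure Decomposition {ι : Type} [Fintype ι] (Q : Fin N → Finset ι) (x : ∀ i, ι → E (d i))
    (β : ℝ) (z : E m) where
  S : Finset (Fin N)
  w : Fin N → ι → ℝ
  l : Fin N → ι
  card_le : S.card ≤ m + 1
  nonneg : ∀ i ∈ S, ∀ k, 0 ≤ w i k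
  supported : ∀ i ∈ S, ∀ k, k ∉ Q i → w i k = 0
  sum_eq_one : ∀ i ∈ S, ∑ k ∈ Q i, w i k = 1
  mem : ∀ i, i ∉ S → l i ∈ Q i
  beta_eq : β = ∑ i ∈ S, ∑ k ∈ Q i, w i k * (1 / (N : ℝ) * P.val i (x i k)) +
    ∑ i ∈ Sᶜ, 1 / (N : ℝ) * P.val i (x i (l i))
  z_eq : z = ∑ i ∈ S, ∑ k ∈ Q i, w i k • ((1 / (N : ℝ)) • P.act i (x i k)) +
    ∑ i ∈ Sᶜ, (1 / (N : ℝ)) • P.act i (x i (l i))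

namespace Decomposition

variable {P} {ι : Type} [Fintype ι] {Q : Fin N → Finset ι} {x : ∀ i, ι → E (d i)}
  {β : ℝ} {z : E m} (D : P.Decomposition Q x β z)

/-- The reconstructed point, for the sampled atom indices `q i`, `i ∈ S`. -/
def recon (q : D.S → ι) (i : Fin N) : E (d i) :=
  if hi : i ∈ D.S then x i (q ⟨i, hi⟩) else x i (D.l i)

/-- Expectation over the sampling: independently for `i ∈ S`, index `k` has probability
`w i k`. -/
def expect (Y : (∀ i, E (d i)) → ℝ) : ℝ :=
  ∑ q : D.S → ι, (∏ i : D.S, D.w i (q i)) * Y (D.recon q)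

end Decomposition

/-! ### The full method -/

/-- The method with given starting points `start` for the second stage (they may depend on the
random indices of the first stage): a choice of a Carathéodory decomposition of `(β^K, z^K)` for
each outcome of the random indices of the two stages. -/
def Method (lam0 : E m) (α ρ : ℕ → ℝ) (T K : ℕ) {ι : Type} [Fintype ι]
    (start : (Fin (T - 1) → Fin N) → Start d ι) : Type :=
  ∀ (ω₁ : Fin (T - 1) → Fin N) (ω₂ : Fin K → Fin N),
    P.Decomposition (atomIdx ω₂ (start ω₁))
      (P.atom orc (P.dual (P.lamBar orc lam0 α ω₁)) ρ ω₂ (start ω₁))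
      (P.betaK orc (P.dual (P.lamBar orc lam0 α ω₁)) ρ ω₂ (start ω₁))
      (P.zK orc (P.dual (P.lamBar orc lam0 α ω₁)) ρ ω₂ (start ω₁))

/-- Total expectation of a function `Y` of the reconstructed point: the indices of both stages
are independent and uniform on `{1, …, N}`, then the atoms are sampled. -/
def Method.expect {P : Problem N m d} {orc : ∀ i, ℝ → E m → E (d i)} {lam0 : E m}
    {α ρ : ℕ → ℝ} {T K : ℕ} {ι : Type} [Fintype ι]
    {start : (Fin (T - 1) → Fin N) → Start d ι} (M : P.Method orc lam0 α ρ T K start)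
    (Y : (∀ i, E (d i)) → ℝ) : ℝ :=
  𝔼 ω₁ : Fin (T - 1) → Fin N, 𝔼 ω₂ : Fin K → Fin N, (M ω₁ ω₂).expect Y

/-- The two guarantees with error term `err`: the expected suboptimality relative to the value
`dstar` is at most `((m+1)/N) max_i γ(f_i) + err`, and every component of the expected constraint
violation is at most `err`. -/
def Method.Guarantee {P : Problem N m d} {orc : ∀ i, ℝ → E m → E (d i)} {lam0 : E m}
    {α ρ : ℕ → ℝ} {T K : ℕ} {ι : Type} [Fintype ι]
    {start : (Fin (T - 1) → Fin N) → Start d ι} (M : P.Method orc lam0 α ρ T K start)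
    (dstar err : ℝ) : Prop :=
  ((M.expect (fun x => (1 / (N : ℝ)) * ∑ i, P.val i (x i) - dstar) : ℝ) : EReal) ≤
      ((((m : ℝ) + 1) / (N : ℝ) : ℝ) : EReal) * (⨆ i, gam (P.f i)) + (err : EReal) ∧
    ∀ j, M.expect (fun x => ((1 / (N : ℝ)) • ∑ i, P.act i (x i) - P.b) j) ≤ err

end Problem

/-- `1/√T + 1/√K + (N/K) (√(N/T) + N/T)`. -/
def rate (N T K : ℕ) : ℝ :=
  1 / √(T : ℝ) + 1 / √(K : ℝ) + (N : ℝ) / K * (√((N : ℝ) / T) + (N : ℝ) / T)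

end

end TwoStage

/-! The reconstruction draws atoms with exactly the weights of the decomposition, so on average it
returns `(β^K, z^K)` (`Decomposition.expect_val`, `Decomposition.expect_act`). With `d̄ = d(λ̄_T) ≤
d*`, both guarantees therefore follow from a bound on the mean of the root of the merit `(β - d̄)_+²
+ ‖[z - b]_+‖²` after stage 2; the nonnegative `γ` term is then pure slack.

Stage 2 is block-coordinate Frank-Wolfe on half the merit, a smooth convex function of the block
sums. A feasible bidual point of value `v` has merit at most `(v - d̄)_+²`, and one draw contracts
the mean excess over this number by `1 - 2/(k + 2N)`, up to an error of order `1/(k + 2N)²`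
(`IsOracle.expect_merit_fwStep_le`). Solving the recursion leaves `O(1/K)` plus `(2N/K)²` times the
initial merit. After taking roots and the infimum over `v`, the bound is `d* - d̄`, plus `2N/K`
times the initial root, plus `O(1/√K)` (`IsDualSolution.expect_sqrt_merit_bcfw_le`).

Stage 1 is a projected stochastic supergradient method: the mean of `d* - d̄` is `O(1/√T)`, and the
iterates have bounded second moments. There remains the initial root. At given points it is bounded
on average, and the factor `2N/K` is absorbed into `1/√K` by a constant depending on `N`. At the
averaged start it is small (`IsDualSolution.sqrt_merit_averagedStart_le`). The ergodic average of
the sampled outputs is nearly feasible, because `λ_{T-1}` dominates `α` times the sum of the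
supergradients. It is nearly optimal, because its excess value is at most a martingale minus `∑
⟨λ_t, g_t⟩`, which telescopes through `‖λ_t‖²`. The block averages differ from it by the fluctuation
of the counts `I_i` and by the one extra atom per block, which costs `√(N/T) + N/T` up to a factor.
-/

open scoped BigOperators

namespace TwoStage

/-! ### Averages over finite products of uniform draws -/

section Expect

/-- Redrawing one coordinate does not change the average over all coordinates. -/
lemma expect_update {n : ℕ} {κ : Type*} [Fintype κ] [Nonempty κ] (t : Fin n)
    (φ : (Fin n → κ) → ℝ) :
    𝔼 ω : Fin n → κ, 𝔼 i : κ, φ (Function.update ω t i) = 𝔼 ω : Fin n → κ, φ ω := by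
  have h1 : 𝔼 p : (Fin n → κ) × κ, φ (Function.update p.1 t p.2) =
      𝔼 p : (Fin n → κ) × κ, φ p.1 := by
    -- Exchanging the redrawn value with the discarded coordinate is an involution of the product
    -- space.
    let e : (Fin n → κ) × κ → (Fin n → κ) × κ := fun p => (Function.update p.1 t p.2, p.1 t)
    have he : Function.Involutive e := by
      rintro ⟨ω, i⟩
      simp [e]
    exact Fintype.expect_equiv he.toPerm _ _ (fun _ => rfl)
  rw [← Finset.univ_product_univ, Finset.expect_product, Finset.expect_product] at h1
  simpa using h1

lemma expect_abs_le_sqrt {κ : Type*} [Fintype κ] [Nonempty κ] (f : κ → ℝ) :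
    𝔼 i, |f i| ≤ √(𝔼 i, f i ^ 2) := by
  apply Real.le_sqrt_of_sq_le
  have h := Finset.expect_mul_sq_le_sq_mul_sq Finset.univ (fun i => |f i|) (fun _ : κ => (1 : ℝ))
  simpa using h

lemma expect_abs_le_of_expect_sq_le {κ : Type*} [Fintype κ] [Nonempty κ] (f : κ → ℝ) {B : ℝ}
    (h : 𝔼 i, f i ^ 2 ≤ B) : 𝔼 i, |f i| ≤ √B :=
  (expect_abs_le_sqrt f).trans (Real.sqrt_le_sqrt h)

/-- The variance of uniform draws is at most the second moment. -/
lemma expect_sub_expect_sq_le {κ : Type*} [Fintype κ] [Nonempty κ] (f : κ → ℝ) :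
    𝔼 i, (f i - 𝔼 j, f j) ^ 2 ≤ 𝔼 i, f i ^ 2 := by
  set a := 𝔼 j, f j with ha
  have h1 : ∀ i, (f i - a) ^ 2 = f i ^ 2 - 2 * a * f i + a ^ 2 := fun i => by ring
  simp only [h1, Finset.expect_add_distrib, Finset.expect_sub_distrib, ← Finset.mul_expect,
    Fintype.expect_const]
  rw [← ha]
  nlinarith [sq_nonneg a]

/-- Second moment of a sum of martingale differences. -/
lemma expect_sum_sq_le {n : ℕ} {κ : Type*} [Fintype κ] [Nonempty κ]
    (ξ : Fin n → (Fin n → κ) → ℝ) {B : ℝ}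
    (adapted : ∀ s t, s < t → ∀ ω i, ξ s (Function.update ω t i) = ξ s ω)
    (centered : ∀ t ω, 𝔼 i, ξ t (Function.update ω t i) = 0)
    (sq_le : ∀ t, 𝔼 ω, ξ t ω ^ 2 ≤ B) :
    𝔼 ω, (∑ t, ξ t ω) ^ 2 ≤ n * B := by
  have key : ∀ k : ℕ, k ≤ n →
      𝔼 ω, (∑ t : Fin n with t.1 < k, ξ t ω) ^ 2 ≤ k * B := by
    intro k
    induction k with
    | zero => simp
    | succ k ih =>
      intro hk
      set t₀ : Fin n := ⟨k, hk⟩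
      have hs : ∀ ω, ∑ t : Fin n with t.1 < k + 1, ξ t ω =
          ξ t₀ ω + ∑ t : Fin n with t.1 < k, ξ t ω := by
        intro ω
        have : (Finset.univ.filter fun t : Fin n => t.1 < k + 1) =
            insert t₀ (Finset.univ.filter fun t : Fin n => t.1 < k) := by
          ext t
          simp only [Finset.mem_filter, Finset.mem_univ, true_and, Finset.mem_insert, t₀,
            Fin.ext_iff]
          omega
        rw [this, Finset.sum_insert (by simp [t₀])]
      -- Redrawing coordinate `k` leaves the earlier terms fixed and averages the new one to zero.
      have hcross : 𝔼 ω, ξ t₀ ω * ∑ t : Fin n with t.1 < k, ξ t ω = 0 := by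
        rw [← expect_update t₀]
        apply Finset.expect_eq_zero
        intro ω _
        have : ∀ i, ∑ t : Fin n with t.1 < k, ξ t (Function.update ω t₀ i) =
            ∑ t : Fin n with t.1 < k, ξ t ω := by
          intro i
          refine Finset.sum_congr rfl fun t ht => adapted t t₀ ?_ ω i
          simpa [t₀, Fin.lt_def] using ht
        simp only [this]
        rw [← Finset.expect_mul, centered, zero_mul]
      have hexp : ∀ ω, (∑ t : Fin n with t.1 < k + 1, ξ t ω) ^ 2 =
          ξ t₀ ω ^ 2 + 2 * (ξ t₀ ω * ∑ t : Fin n with t.1 < k, ξ t ω) +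
            (∑ t : Fin n with t.1 < k, ξ t ω) ^ 2 := by
        intro ω; rw [hs]; ring
      simp only [hexp, Finset.expect_add_distrib, ← Finset.mul_expect]
      rw [hcross]
      have := ih (by omega)
      have := sq_le t₀
      push_cast
      linarith
  simpa using key n le_rfl

end Expect

/-! ### The positive part in `ℝ^m` -/

section Pos

/-- The function `a_+²` is convex with the 2-Lipschitz derivative `2 a_+`. This is the resulting
upper quadratic bound, which gives the Frank-Wolfe descent; `sq_max_ge` is the tangent bound, used
to compare with a feasible point. -/
lemma sq_max_add_le (a e : ℝ) : max (a + e) 0 ^ 2 ≤ max a 0 ^ 2 + 2 * (max a 0 * e) + e ^ 2 := by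
  rcases le_total a 0 with ha | ha <;> rcases le_total (a + e) 0 with hb | hb <;>
    simp only [max_eq_left, max_eq_right, ha, hb] <;> nlinarith

lemma sq_max_ge (a b : ℝ) : max a 0 ^ 2 + 2 * (max a 0 * (b - a)) ≤ max b 0 ^ 2 := by
  rcases le_total a 0 with ha | ha <;> rcases le_total b 0 with hb | hb <;>
    simp only [max_eq_left, max_eq_right, ha, hb] <;> nlinarith [sq_nonneg (a - b)]

variable {m : ℕ}

@[simp] lemma projPos_apply (v : E m) (j : Fin m) : projPos v j = max (v j) 0 := rfl

lemma norm_sq_eq (v : E m) : ‖v‖ ^ 2 = ∑ j, v j ^ 2 := by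
  simp [EuclideanSpace.norm_sq_eq]

lemma inner_eq (v w : E m) : inner ℝ v w = ∑ j, v j * w j := by
  simp [PiLp.inner_apply, mul_comm]

lemma norm_sq_projPos_add_le (v w : E m) :
    ‖projPos (v + w)‖ ^ 2 ≤ ‖projPos v‖ ^ 2 + 2 * inner ℝ (projPos v) w + ‖w‖ ^ 2 := by
  simp only [norm_sq_eq, inner_eq, Finset.mul_sum, ← Finset.sum_add_distrib]
  exact Finset.sum_le_sum fun j _ => sq_max_add_le (v j) (w j)

lemma norm_sq_projPos_ge (v w : E m) :
    ‖projPos v‖ ^ 2 + 2 * inner ℝ (projPos v) (w - v) ≤ ‖projPos w‖ ^ 2 := by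
  simp only [norm_sq_eq, inner_eq, Finset.mul_sum, ← Finset.sum_add_distrib]
  exact Finset.sum_le_sum fun j _ => sq_max_ge (v j) (w j)

/-- Projecting onto the orthant does not increase the distance to its points. -/
lemma norm_projPos_sub_le (v μ : E m) (hμ : ∀ j, 0 ≤ μ j) : ‖projPos v - μ‖ ≤ ‖v - μ‖ := by
  apply le_of_sq_le_sq _ (norm_nonneg _)
  simp only [norm_sq_eq]
  refine Finset.sum_le_sum fun j _ => ?_
  have := hμ j
  simp only [PiLp.sub_apply, projPos_apply]
  rcases le_total (v j) 0 with h | h <;> simp only [max_eq_left, max_eq_right, h] <;> nlinarith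

lemma norm_le_norm_of_abs_le {v w : E m} (h : ∀ j, |v j| ≤ |w j|) : ‖v‖ ≤ ‖w‖ := by
  apply le_of_sq_le_sq _ (norm_nonneg _)
  simp only [norm_sq_eq]
  exact Finset.sum_le_sum fun j _ => sq_le_sq.2 (h j)

lemma norm_projPos_le (v : E m) : ‖projPos v‖ ≤ ‖v‖ :=
  norm_le_norm_of_abs_le fun j => by
    rw [projPos_apply, abs_of_nonneg (le_max_right _ _)]
    exact max_le (le_abs_self _) (abs_nonneg _)

lemma norm_projPos_le_of_le {v w : E m} (h : ∀ j, v j ≤ w j) (hw : ∀ j, 0 ≤ w j) :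
    ‖projPos v‖ ≤ ‖w‖ :=
  norm_le_norm_of_abs_le fun j => by
    rw [projPos_apply, abs_of_nonneg (le_max_right _ _), abs_of_nonneg (hw j)]
    exact max_le (h j) (hw j)

lemma norm_projPos_add_le (v w : E m) : ‖projPos (v + w)‖ ≤ ‖projPos v‖ + ‖w‖ := by
  apply le_of_sq_le_sq _ (by positivity)
  have h1 := norm_sq_projPos_add_le v w
  have h2 := real_inner_le_norm (projPos v) w
  nlinarith

lemma projPos_eq_zero {v : E m} (h : ∀ j, v j ≤ 0) : projPos v = 0 := by
  ext j; simpa using h j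

lemma apply_le_norm_projPos (v : E m) (j : Fin m) : v j ≤ ‖projPos v‖ :=
  (le_max_left _ 0).trans <| (le_abs_self _).trans <| by
    simpa using PiLp.norm_apply_le (projPos v) j

end Pos

end TwoStage

namespace TwoStage

/-- A point of the domain, where `f` is finite, bounds the infimum away from `⊤` and the supremum
away from `⊥`, so that the subtraction in `EReal` behaves as expected. -/
lemma gam_nonneg {n : ℕ} {f : E n → EReal} (hf : IsAdmissible f) : 0 ≤ gam f := by
  obtain ⟨x, hx⟩ := hf.dom_nonempty
  have h1 : ⨅ y ∈ dom f, f y ≤ f x := iInf₂_le x hx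
  have h2 : f x ≤ ⨆ y ∈ dom f, f y := le_iSup₂ (f := fun y _ => f y) x hx
  have hbot : f x ≠ ⊥ := hf.ne_bot x
  rw [gam, EReal.sub_nonneg]
  · exact h1.trans h2
  · exact Or.inr (ne_top_of_le_ne_top hx.ne h1)
  · exact Or.inl (fun h => hbot (le_bot_iff.1 (h ▸ h2)))

namespace Problem

variable {N m : ℕ} {d : Fin N → ℕ} {P : Problem N m d}

/-! ### Reconstruction preserves the combination on average -/

section Recon

variable {ι : Type} [Fintype ι] {Q : Fin N → Finset ι} {x : ∀ i, ι → E (d i)}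
  {β : ℝ} {z : E m} (D : P.Decomposition Q x β z)

lemma Decomposition.sum_w (i : Fin N) (hi : i ∈ D.S) : ∑ k, D.w i k = 1 := by
  rw [← D.sum_eq_one i hi]
  exact (Finset.sum_subset (Finset.subset_univ _)
    fun k _ hk => D.supported i hi k hk).symm

lemma Decomposition.sum_prod_w : ∑ q : D.S → ι, ∏ i : D.S, D.w i (q i) = 1 := by
  classical
  rw [← Fintype.piFinset_univ, ← Finset.prod_univ_sum (fun _ => Finset.univ)
    (fun (i : D.S) k => D.w i k)]
  exact Finset.prod_eq_one fun i _ => D.sum_w i i.2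

/-- Marginal of a product law: `c` is absorbed into the factor `j`, and every other factor sums to
one. -/
lemma Decomposition.sum_prod_w_mul (j : D.S) (c : ι → ℝ) :
    ∑ q : D.S → ι, (∏ i : D.S, D.w i (q i)) * c (q j) = ∑ k ∈ Q j, D.w j k * c k := by
  classical
  have h1 : ∀ q : D.S → ι, (∏ i : D.S, D.w i (q i)) * c (q j) =
      ∏ i : D.S, D.w i (q i) * (if i = j then c (q i) else 1) := by
    intro q
    rw [Finset.prod_mul_distrib]
    simp
  simp only [h1]
  rw [← Fintype.piFinset_univ, ← Finset.prod_univ_sum (fun _ => Finset.univ)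
    (fun (i : D.S) k => D.w i k * (if i = j then c k else 1)),
    Finset.prod_eq_single j]
  · simp only [if_true]
    exact (Finset.sum_subset (Finset.subset_univ _)
      fun k _ hk => by rw [D.supported j j.2 k hk, zero_mul]).symm
  · intro i _ hij
    simpa [hij] using D.sum_w i i.2
  · simp

/-- By linearity a separable sum sees only the marginals, so the sampling introduces no bias. -/
lemma Decomposition.expect_sum_sub (c : ∀ i, E (d i) → ℝ) (a : ℝ) :
    D.expect (fun y => ∑ i, c i (y i) - a) =
      (∑ i ∈ D.S, ∑ k ∈ Q i, D.w i k * c i (x i k) + ∑ i ∈ D.Sᶜ, c i (x i (D.l i))) - a := by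
  classical
  have hsplit : ∀ q : D.S → ι, ∑ i, c i (D.recon q i) =
      ∑ i : D.S, c i (x i (q i)) + ∑ i ∈ D.Sᶜ, c i (x i (D.l i)) := by
    intro q
    rw [← Finset.sum_add_sum_compl D.S, ← Finset.sum_coe_sort D.S]
    congr 1
    · exact Finset.sum_congr rfl fun i _ => by simp [Decomposition.recon]
    · refine Finset.sum_congr rfl fun i hi => ?_
      rw [Decomposition.recon, dif_neg (Finset.mem_compl.1 hi)]
  simp only [Decomposition.expect, hsplit, mul_sub, mul_add, Finset.sum_sub_distrib,
    Finset.sum_add_distrib]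
  rw [← Finset.sum_mul, ← Finset.sum_mul, D.sum_prod_w, one_mul, one_mul]
  congr 2
  simp only [Finset.mul_sum]
  rw [Finset.sum_comm, ← Finset.sum_coe_sort D.S]
  exact Finset.sum_congr rfl fun j _ => D.sum_prod_w_mul j (fun k => c j (x j k))

lemma Decomposition.expect_val (a : ℝ) :
    D.expect (fun y => (1 / (N : ℝ)) * ∑ i, P.val i (y i) - a) = β - a := by
  simp only [Finset.mul_sum]
  rw [D.expect_sum_sub (fun i y => 1 / (N : ℝ) * P.val i y) a, ← D.beta_eq]

lemma Decomposition.expect_act (j : Fin m) :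
    D.expect (fun y => ((1 / (N : ℝ)) • ∑ i, P.act i (y i) - P.b) j) = (z - P.b) j := by
  have h : ∀ y : ∀ i, E (d i), ((1 / (N : ℝ)) • ∑ i, P.act i (y i) - P.b) j =
      ∑ i, 1 / (N : ℝ) * P.act i (y i) j - P.b j := by
    intro y
    simp [Finset.mul_sum]
  simp only [h]
  rw [D.expect_sum_sub (fun i y => 1 / (N : ℝ) * P.act i y j) (P.b j), PiLp.sub_apply]
  congr 1
  conv_rhs => rw [D.z_eq]
  simp

end Recon

/-! ### Bounds and the oracle -/

lemma subset_X (i : Fin N) : dom (P.f i) ⊆ P.X i := subset_convexHull ℝ _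

/-- The real supremum is a genuine upper bound here: each `X_i` is bounded, being the hull of a
compact set, and there are finitely many blocks. -/
lemma norm_act_sub_le_Gtilde (hP : ∀ i, IsAdmissible (P.f i)) (i : Fin N) (x : E (d i))
    (hx : x ∈ P.X i) : ‖P.act i x - P.b‖ ≤ P.Gtilde := by
  refine le_csSup ?_ ⟨i, x, hx, rfl⟩
  have hc : ∀ i, BddAbove ((fun x => ‖P.act i x - P.b‖) '' P.X i) := fun i => by
    have hb : Bornology.IsBounded (P.X i) := isBounded_convexHull.2 (hP i).compact_dom.isBounded
    have hc : Continuous (P.act i) := (Matrix.toEuclideanLin (P.A i)).continuous_of_finiteDimensional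
    refine BddAbove.mono (Set.image_mono subset_closure)
      (hb.isCompact_closure.bddAbove_image (Continuous.continuousOn ?_))
    fun_prop
  choose B hB using hc
  refine ⟨∑ i, |B i|, ?_⟩
  rintro r ⟨i, x, hx, rfl⟩
  calc ‖P.act i x - P.b‖ ≤ B i := hB i ⟨x, hx, rfl⟩
    _ ≤ |B i| := le_abs_self _
    _ ≤ ∑ i, |B i| := Finset.single_le_sum (f := fun i => |B i|) (fun _ _ => abs_nonneg _)
        (Finset.mem_univ i)

lemma Gtilde_nonneg : 0 ≤ P.Gtilde := by
  apply Real.sSup_nonneg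
  rintro r ⟨i, x, _, rfl⟩
  exact norm_nonneg _

variable {orc : ∀ i, ℝ → E m → E (d i)}

lemma IsOracle.mem_X (ho : P.IsOracle orc) (i : Fin N) {g : ℝ} (hg : 0 ≤ g) (lam : E m) :
    orc i g lam ∈ P.X i :=
  subset_X i (ho.mem_dom i g lam hg)

lemma IsOracle.val_eq (ho : P.IsOracle orc) (i : Fin N) {g : ℝ} (hg : 0 ≤ g) (lam : E m) :
    P.val i (orc i g lam) = P.h i (orc i g lam) := by
  rw [val, h, ho.matches_biconj i g lam hg]

variable (P orc) in
/-- The stochastic supergradient `A_i x_i^*(λ) - b` of the dual function. -/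
noncomputable def sgrad (i : Fin N) (lam : E m) : E m := P.act i (orc i 1 lam) - P.b

variable (P orc) in
/-- The `i`-th term of the dual function, `f_i^{**}(x_i^*(λ)) + ⟨λ, A_i x_i^*(λ) - b⟩`. -/
noncomputable def lag (i : Fin N) (lam : E m) : ℝ :=
  P.h i (orc i 1 lam) + inner ℝ lam (P.sgrad orc i lam)

lemma IsOracle.sInf_eq (ho : P.IsOracle orc) (i : Fin N) (lam : E m) :
    sInf ((fun x => P.h i x + inner ℝ lam (P.act i x)) '' P.X i) =
      P.h i (orc i 1 lam) + inner ℝ lam (P.act i (orc i 1 lam)) := by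
  apply IsLeast.csInf_eq
  refine ⟨⟨_, ho.mem_X i zero_le_one lam, rfl⟩, ?_⟩
  rintro _ ⟨y, hy, rfl⟩
  simpa using ho.minimizes i 1 lam zero_le_one y hy

lemma IsOracle.dual_eq (ho : P.IsOracle orc) (hN : 1 ≤ N) (lam : E m) :
    P.dual lam = 𝔼 i, P.lag orc i lam := by
  have hN' : (N : ℝ) ≠ 0 := by positivity
  simp only [dual, ho.sInf_eq, lag, sgrad, inner_sub_right, Fintype.expect_eq_sum_div_card,
    Fintype.card_fin, Finset.sum_add_distrib, Finset.sum_sub_distrib, Finset.sum_const,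
    Finset.card_univ, nsmul_eq_mul]
  field_simp
  ring

/-- The point `x_i^*(λ)` competes in the minimization at `μ`, and the Lagrangian at a fixed point is
affine in the multiplier. -/
lemma IsOracle.lag_le (ho : P.IsOracle orc) (i : Fin N) (lam μ : E m) :
    P.lag orc i μ ≤ P.lag orc i lam + inner ℝ (P.sgrad orc i lam) (μ - lam) := by
  have h1 := ho.minimizes i 1 μ zero_le_one _ (ho.mem_X i zero_le_one lam)
  have h2 := real_inner_comm (P.sgrad orc i lam) (μ - lam)
  simp only [lag, sgrad, inner_sub_right, inner_sub_left, one_mul] at h1 h2 ⊢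
  linarith

/-- `𝔼_i (A_i x_i^*(λ) - b)` is a supergradient of the dual function at `λ`. -/
lemma IsOracle.dual_le (ho : P.IsOracle orc) (hN : 1 ≤ N) (lam μ : E m) :
    P.dual μ ≤ P.dual lam + 𝔼 i, inner ℝ (P.sgrad orc i lam) (μ - lam) := by
  rw [ho.dual_eq hN, ho.dual_eq hN, ← Finset.expect_add_distrib]
  exact Finset.expect_le_expect fun i _ => ho.lag_le i lam μ

/-- Jensen's inequality for the concave dual function. -/
lemma IsOracle.avg_dual_le (ho : P.IsOracle orc) (hN : 1 ≤ N) {T : ℕ} (hT : 1 ≤ T)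
    (lam : ℕ → E m) :
    (1 / (T : ℝ)) * ∑ t ∈ Finset.range T, P.dual (lam t) ≤
      P.dual ((1 / (T : ℝ)) • ∑ t ∈ Finset.range T, lam t) := by
  have hT' : (T : ℝ) ≠ 0 := by positivity
  set μ := (1 / (T : ℝ)) • ∑ t ∈ Finset.range T, lam t with hμ
  have h1 : ∑ t ∈ Finset.range T, P.dual (lam t) ≤ ∑ t ∈ Finset.range T,
      (P.dual μ + 𝔼 i, inner ℝ (P.sgrad orc i μ) (lam t - μ)) :=
    Finset.sum_le_sum fun t _ => ho.dual_le hN μ (lam t)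
  -- The supergradient inequality is taken at the mean `μ`, where the linear terms cancel.
  have h2 : ∑ t ∈ Finset.range T, (lam t - μ) = 0 := by
    rw [Finset.sum_sub_distrib, Finset.sum_const, Finset.card_range, hμ,
      ← Nat.cast_smul_eq_nsmul ℝ, smul_smul, mul_one_div_cancel hT', one_smul, sub_self]
  rw [Finset.sum_add_distrib, ← Finset.expect_sum_comm] at h1
  simp only [← inner_sum, h2, inner_zero_right, Finset.expect_const_zero, add_zero,
    Finset.sum_const, Finset.card_range, nsmul_eq_mul] at h1
  rw [one_div, inv_mul_le_iff₀ (by positivity)]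
  exact h1

/-- The value of the dual optimum lies within the bounds on the `f_i^{**}`. -/
lemma IsDualSolution.abs_dual_le {lamStar : E m} (hd : P.IsDualSolution lamStar) (hN : 1 ≤ N)
    {H : ℝ} (hH : ∀ i, ∀ x ∈ P.X i, |P.h i x| ≤ H) : |P.dual lamStar| ≤ H := by
  have hb : ∀ x, P.BidualFeasible x → |(1 / (N : ℝ)) * ∑ i, P.h i (x i)| ≤ H := by
    intro x hx
    have hN' : (0 : ℝ) < N := by positivity
    rw [abs_mul, abs_of_nonneg (by positivity), one_div, inv_mul_le_iff₀ hN']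
    refine (Finset.abs_sum_le_sum_abs _ _).trans ?_
    calc ∑ i, |P.h i (x i)| ≤ ∑ _i : Fin N, H := Finset.sum_le_sum fun i _ => hH i _ (hx.1 i)
      _ = N * H := by simp
  obtain ⟨v, x, hx, rfl⟩ : {v : ℝ | ∃ x, P.BidualFeasible x ∧
      v = (1 / (N : ℝ)) * ∑ i, P.h i (x i)}.Nonempty := hd.strong_duality.nonempty
  rw [abs_le]
  constructor
  · rw [le_isGLB_iff hd.strong_duality]
    rintro _ ⟨y, hy, rfl⟩
    exact (abs_le.1 (hb y hy)).1
  · exact (hd.strong_duality.1 ⟨x, hx, rfl⟩).trans (abs_le.1 (hb x hx)).2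

end Problem

end TwoStage

namespace TwoStage

namespace Problem

variable {N m : ℕ} {d : Fin N → ℕ} {P : Problem N m d} {orc : ∀ i, ℝ → E m → E (d i)}

/-! ### The stochastic dual subgradient method -/

section Stage1

variable {T : ℕ} {α : ℝ}

lemma dualIter_zero (ω : Fin (T - 1) → Fin N) : P.dualIter orc 0 (fun _ => α) ω 0 = 0 := rfl

lemma dualIter_succ (ω : Fin (T - 1) → Fin N) (t : Fin (T - 1)) :
    P.dualIter orc 0 (fun _ => α) ω (t + 1) =
      projPos (P.dualIter orc 0 (fun _ => α) ω t +
        α • P.sgrad orc (ω t) (P.dualIter orc 0 (fun _ => α) ω t)) := by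
  rw [dualIter]
  simp [sgrad]

lemma dualIter_nonneg (ω : Fin (T - 1) → Fin N) (t : ℕ) (j : Fin m) :
    0 ≤ P.dualIter orc 0 (fun _ => α) ω t j := by
  cases t with
  | zero => simp [dualIter_zero]
  | succ t =>
    rw [dualIter]
    dsimp only
    split_ifs <;> exact le_max_right _ _

/-- Dual feasibility of `λ̄_T` is what gives `d(λ̄_T) ≤ d*`. -/
lemma lamBar_nonneg (ω : Fin (T - 1) → Fin N) (j : Fin m) :
    0 ≤ P.lamBar orc 0 (fun _ => α) ω j := by
  rw [lamBar]
  simp only [PiLp.smul_apply, WithLp.ofLp_sum, Finset.sum_apply, smul_eq_mul]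
  exact mul_nonneg (by positivity) (Finset.sum_nonneg fun t _ => dualIter_nonneg ω t j)

/-- The `s`-th iterate depends only on the draws before step `s`. -/
lemma dualIter_update (ω : Fin (T - 1) → Fin N) (t : Fin (T - 1)) (i : Fin N) (s : ℕ)
    (hs : s ≤ t) :
    P.dualIter orc 0 (fun _ => α) (Function.update ω t i) s =
      P.dualIter orc 0 (fun _ => α) ω s := by
  induction s with
  | zero => rfl
  | succ s ih =>
    have hlt : s < T - 1 := lt_of_lt_of_le hs t.2.le
    have hne : (⟨s, hlt⟩ : Fin (T - 1)) ≠ t := fun h => by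
      rw [← h] at hs; simp at hs
    have h1 := dualIter_succ (P := P) (orc := orc) (α := α) (Function.update ω t i) ⟨s, hlt⟩
    have h2 := dualIter_succ (P := P) (orc := orc) (α := α) ω ⟨s, hlt⟩
    simp only [Function.update_of_ne hne] at h1 h2
    rw [h1, h2, ih (by omega)]

/-- Averaging, over the `t`-th draw only, a function of this draw and of the iterate. -/
lemma expect_draw [NeZero N] (t : Fin (T - 1)) (φ : Fin N → E m → ℝ) :
    𝔼 ω : Fin (T - 1) → Fin N, φ (ω t) (P.dualIter orc 0 (fun _ => α) ω t) =
      𝔼 ω : Fin (T - 1) → Fin N, 𝔼 i, φ i (P.dualIter orc 0 (fun _ => α) ω t) := by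
  rw [← expect_update t]
  simp only [Function.update_self, dualIter_update _ t _ _ le_rfl]

variable {G : ℝ}

lemma norm_sq_step_sub_le (hG : ∀ i lam, ‖P.sgrad orc i lam‖ ≤ G) (lam μ : E m)
    (hμ : ∀ j, 0 ≤ μ j) (i : Fin N) :
    ‖projPos (lam + α • P.sgrad orc i lam) - μ‖ ^ 2 ≤
      ‖lam - μ‖ ^ 2 + 2 * α * inner ℝ (P.sgrad orc i lam) (lam - μ) + α ^ 2 * G ^ 2 := by
  have h1 := norm_projPos_sub_le (lam + α • P.sgrad orc i lam) μ hμ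
  have h2 : lam + α • P.sgrad orc i lam - μ = (lam - μ) + α • P.sgrad orc i lam := by abel
  have h3 := pow_le_pow_left₀ (norm_nonneg _) h1 2
  have h4 := pow_le_pow_left₀ (norm_nonneg _) (hG i lam) 2
  rw [h2, norm_add_sq_real, inner_smul_right, norm_smul, mul_pow, Real.norm_eq_abs, sq_abs,
    real_inner_comm] at h3
  nlinarith [mul_le_mul_of_nonneg_left h4 (sq_nonneg α)]

lemma IsOracle.expect_step_le [NeZero N] (ho : P.IsOracle orc)
    (hG : ∀ i lam, ‖P.sgrad orc i lam‖ ≤ G) (hα : 0 ≤ α) (lam μ : E m) (hμ : ∀ j, 0 ≤ μ j) :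
    𝔼 i, ‖projPos (lam + α • P.sgrad orc i lam) - μ‖ ^ 2 ≤
      ‖lam - μ‖ ^ 2 - 2 * α * (P.dual μ - P.dual lam) + α ^ 2 * G ^ 2 := by
  have h1 := Finset.expect_le_expect (s := Finset.univ)
    fun i _ => norm_sq_step_sub_le (α := α) hG lam μ hμ i
  simp only [Finset.expect_add_distrib, ← Finset.mul_expect, Fintype.expect_const] at h1
  have h2 := ho.dual_le NeZero.one_le lam μ
  have h3 : 𝔼 i, inner ℝ (P.sgrad orc i lam) (μ - lam) =
      - 𝔼 i, inner ℝ (P.sgrad orc i lam) (lam - μ) := by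
    rw [← Finset.expect_neg_distrib]
    simp only [← inner_neg_right, neg_sub]
  nlinarith

/-- The one-step bound telescopes. At `μ = λ*` both terms on the left are nonnegative: the first
controls the second moments of the iterates, the second the dual gap. -/
lemma IsOracle.expect_norm_sq_sub_le [NeZero N] (ho : P.IsOracle orc)
    (hG : ∀ i lam, ‖P.sgrad orc i lam‖ ≤ G) (hα : 0 ≤ α) (μ : E m) (hμ : ∀ j, 0 ≤ μ j)
    (t : ℕ) (ht : t ≤ T - 1) :
    𝔼 ω : Fin (T - 1) → Fin N, ‖P.dualIter orc 0 (fun _ => α) ω t - μ‖ ^ 2 +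
        2 * α * ∑ s ∈ Finset.range t, 𝔼 ω : Fin (T - 1) → Fin N,
          (P.dual μ - P.dual (P.dualIter orc 0 (fun _ => α) ω s)) ≤
      ‖μ‖ ^ 2 + t * (α ^ 2 * G ^ 2) := by
  induction t with
  | zero => simp [dualIter_zero]
  | succ t ih =>
    have ih := ih (by omega)
    let t₀ : Fin (T - 1) := ⟨t, ht⟩
    have h1 : 𝔼 ω : Fin (T - 1) → Fin N, ‖P.dualIter orc 0 (fun _ => α) ω (t + 1) - μ‖ ^ 2 =
        𝔼 ω : Fin (T - 1) → Fin N, 𝔼 i,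
          ‖projPos (P.dualIter orc 0 (fun _ => α) ω t +
            α • P.sgrad orc i (P.dualIter orc 0 (fun _ => α) ω t)) - μ‖ ^ 2 := by
      rw [← expect_draw t₀ (fun i lam => ‖projPos (lam + α • P.sgrad orc i lam) - μ‖ ^ 2)]
      exact Finset.expect_congr rfl fun ω _ => by rw [← dualIter_succ ω t₀]
    have h2 := Finset.expect_le_expect (s := Finset.univ) fun (ω : Fin (T - 1) → Fin N) _ =>
      ho.expect_step_le hG hα (P.dualIter orc 0 (fun _ => α) ω t) μ hμ
    rw [← h1] at h2
    simp only [Finset.expect_add_distrib, Finset.expect_sub_distrib, ← Finset.mul_expect,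
      Fintype.expect_const] at h2
    rw [Finset.sum_range_succ]
    simp only [Finset.expect_sub_distrib, Fintype.expect_const] at ih ⊢
    push_cast
    linarith

/-- Second moment of the distance of the dual iterates to a dual solution. -/
lemma IsDualSolution.expect_norm_sq_le [NeZero N] {lamStar : E m}
    (hd : P.IsDualSolution lamStar) (ho : P.IsOracle orc)
    (hG : ∀ i lam, ‖P.sgrad orc i lam‖ ≤ G) (hα : 0 ≤ α) (t : ℕ) (ht : t ≤ T - 1) :
    𝔼 ω : Fin (T - 1) → Fin N, ‖P.dualIter orc 0 (fun _ => α) ω t‖ ^ 2 ≤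
      4 * ‖lamStar‖ ^ 2 + 2 * (T * (α ^ 2 * G ^ 2)) := by
  have h1 := ho.expect_norm_sq_sub_le hG hα lamStar hd.nonneg t ht
  have h2 : 0 ≤ ∑ s ∈ Finset.range t, 𝔼 ω : Fin (T - 1) → Fin N,
      (P.dual lamStar - P.dual (P.dualIter orc 0 (fun _ => α) ω s)) :=
    Finset.sum_nonneg fun s _ => Finset.expect_nonneg fun ω _ =>
      sub_nonneg.2 (hd.isMax _ (dualIter_nonneg ω s))
  have h3 : 𝔼 ω : Fin (T - 1) → Fin N, ‖P.dualIter orc 0 (fun _ => α) ω t‖ ^ 2 ≤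
      𝔼 ω : Fin (T - 1) → Fin N,
        (2 * ‖P.dualIter orc 0 (fun _ => α) ω t - lamStar‖ ^ 2 + 2 * ‖lamStar‖ ^ 2) := by
    refine Finset.expect_le_expect fun ω _ => ?_
    have h := norm_add_le (P.dualIter orc 0 (fun _ => α) ω t - lamStar) lamStar
    rw [sub_add_cancel] at h
    have := pow_le_pow_left₀ (norm_nonneg _) h 2
    nlinarith [sq_nonneg (‖P.dualIter orc 0 (fun _ => α) ω t - lamStar‖ - ‖lamStar‖)]
  simp only [Finset.expect_add_distrib, ← Finset.mul_expect, Fintype.expect_const] at h3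
  have h4 : (t : ℝ) * (α ^ 2 * G ^ 2) ≤ T * (α ^ 2 * G ^ 2) := by
    gcongr
    omega
  have := mul_nonneg (mul_nonneg zero_le_two hα) h2
  linarith

/-- The duality gap of the averaged dual output. -/
lemma IsDualSolution.expect_gap_le [NeZero N] {lamStar : E m}
    (hd : P.IsDualSolution lamStar) (ho : P.IsOracle orc)
    (hG : ∀ i lam, ‖P.sgrad orc i lam‖ ≤ G) (hα : 0 ≤ α) (hT : 1 ≤ T) :
    2 * α * (T * 𝔼 ω : Fin (T - 1) → Fin N,
        (P.dual lamStar - P.dual (P.lamBar orc 0 (fun _ => α) ω))) ≤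
      ‖lamStar‖ ^ 2 + T * (α ^ 2 * G ^ 2) := by
  have hT' : (0 : ℝ) < T := by positivity
  have h1 := ho.expect_norm_sq_sub_le (T := T) hG hα lamStar hd.nonneg (T - 1) le_rfl
  -- There are `T - 1` draws but `T` iterates in the average. The gap at `λ_{T-1}` is covered by one
  -- fictitious further step, averaged over its index.
  have h2 : 0 ≤ 𝔼 ω : Fin (T - 1) → Fin N,
      (‖P.dualIter orc 0 (fun _ => α) ω (T - 1) - lamStar‖ ^ 2 -
        2 * α * (P.dual lamStar - P.dual (P.dualIter orc 0 (fun _ => α) ω (T - 1))) +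
        α ^ 2 * G ^ 2) :=
    Finset.expect_nonneg fun ω _ =>
      (Finset.expect_nonneg fun i _ => sq_nonneg _).trans
        (ho.expect_step_le hG hα (P.dualIter orc 0 (fun _ => α) ω (T - 1)) lamStar hd.nonneg)
  have h3 : T * 𝔼 ω : Fin (T - 1) → Fin N,
        (P.dual lamStar - P.dual (P.lamBar orc 0 (fun _ => α) ω)) ≤
      ∑ s ∈ Finset.range T, 𝔼 ω : Fin (T - 1) → Fin N,
        (P.dual lamStar - P.dual (P.dualIter orc 0 (fun _ => α) ω s)) := by
    rw [← Finset.expect_sum_comm, Finset.mul_expect]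
    refine Finset.expect_le_expect fun ω _ => ?_
    have := ho.avg_dual_le NeZero.one_le hT (P.dualIter orc 0 (fun _ => α) ω)
    rw [← lamBar, one_div, inv_mul_le_iff₀ hT'] at this
    rw [Finset.sum_sub_distrib, Finset.sum_const, Finset.card_range, nsmul_eq_mul, mul_sub]
    exact sub_le_sub_left this _
  have h4 := mul_le_mul_of_nonneg_left h3 (mul_nonneg zero_le_two hα)
  obtain ⟨n, rfl⟩ : ∃ n, T = n + 1 := ⟨T - 1, by omega⟩
  rw [Finset.sum_range_succ] at h4
  simp only [Finset.expect_add_distrib, Finset.expect_sub_distrib, ← Finset.mul_expect,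
    Fintype.expect_const, Nat.add_sub_cancel] at h1 h2 h4 ⊢
  push_cast at h4 ⊢
  linarith

/-- The positive part of the sum of the sampled supergradients. -/
lemma norm_projPos_sum_sgrad_le (hG : ∀ i lam, ‖P.sgrad orc i lam‖ ≤ G) (hα : 0 ≤ α)
    (hαG : α = 0 → G = 0) (ω : Fin (T - 1) → Fin N) :
    ‖projPos (∑ t, P.sgrad orc (ω t) (P.dualIter orc 0 (fun _ => α) ω t))‖ ≤
      ‖P.dualIter orc 0 (fun _ => α) ω (T - 1)‖ / α := by
  -- A zero step occurs only for `G = 0`; then all supergradients vanish and the division by `α` is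
  -- harmless.
  rcases hα.eq_or_lt with h0 | h0
  · have : ∀ i lam, P.sgrad orc i lam = 0 := fun i lam =>
      norm_le_zero_iff.1 (hαG h0.symm ▸ hG i lam)
    simp only [this, Finset.sum_const_zero]
    rw [projPos_eq_zero (fun j => by simp), norm_zero]
    positivity
  · have h1 : ‖P.dualIter orc 0 (fun _ => α) ω (T - 1)‖ / α =
        ‖α⁻¹ • P.dualIter orc 0 (fun _ => α) ω (T - 1)‖ := by
      rw [norm_smul, Real.norm_of_nonneg (by positivity), div_eq_inv_mul]
    rw [h1]
    have hn := dualIter_nonneg (P := P) (orc := orc) (α := α) ω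
    refine norm_projPos_le_of_le (fun j => ?_) fun j => ?_
    · simp only [PiLp.smul_apply, smul_eq_mul]
      rw [le_inv_mul_iff₀ h0]
      -- The increments telescope from `λ_0 = 0`, and clipping at zero only raises them above `α`
      -- times the supergradient.
      have h2 : P.dualIter orc 0 (fun _ => α) ω (T - 1) j =
          ∑ t : Fin (T - 1), (P.dualIter orc 0 (fun _ => α) ω (t + 1) j -
            P.dualIter orc 0 (fun _ => α) ω t j) := by
        rw [Fin.sum_univ_eq_sum_range (fun t => P.dualIter orc 0 (fun _ => α) ω (t + 1) j -
            P.dualIter orc 0 (fun _ => α) ω t j), Finset.sum_range_sub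
            (fun t => P.dualIter orc 0 (fun _ => α) ω t j), dualIter_zero]
        simp
      rw [h2, WithLp.ofLp_sum, Finset.sum_apply, Finset.mul_sum]
      refine Finset.sum_le_sum fun t _ => ?_
      rw [dualIter_succ, projPos_apply, le_sub_iff_add_le']
      exact le_max_left _ _
    · simp only [PiLp.smul_apply, smul_eq_mul]
      exact mul_nonneg (by positivity) (hn _ j)

lemma neg_sum_inner_sgrad_le (hG : ∀ i lam, ‖P.sgrad orc i lam‖ ≤ G) (hα : 0 ≤ α)
    (hαG : α = 0 → G = 0) (ω : Fin (T - 1) → Fin N) :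
    -∑ t : Fin (T - 1), inner ℝ (P.dualIter orc 0 (fun _ => α) ω t)
        (P.sgrad orc (ω t) (P.dualIter orc 0 (fun _ => α) ω t)) ≤ T * (α * G ^ 2 / 2) := by
  rcases hα.eq_or_lt with h0 | h0
  · have : ∀ i lam, P.sgrad orc i lam = 0 := fun i lam =>
      norm_le_zero_iff.1 (hαG h0.symm ▸ hG i lam)
    simp [this, ← h0]
  -- The squared norms telescope to `‖λ_{T-1}‖² ≥ 0`; each increment is bounded by the step
  -- inequality with `μ = 0`.
  · have h1 : 0 ≤ ∑ t : Fin (T - 1), (2 * α * inner ℝ (P.dualIter orc 0 (fun _ => α) ω t)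
        (P.sgrad orc (ω t) (P.dualIter orc 0 (fun _ => α) ω t)) + α ^ 2 * G ^ 2) := by
      calc 0 ≤ ‖P.dualIter orc 0 (fun _ => α) ω (T - 1)‖ ^ 2 := sq_nonneg _
        _ = ∑ t : Fin (T - 1), (‖P.dualIter orc 0 (fun _ => α) ω (t + 1)‖ ^ 2 -
            ‖P.dualIter orc 0 (fun _ => α) ω t‖ ^ 2) := by
          rw [Fin.sum_univ_eq_sum_range (fun t => ‖P.dualIter orc 0 (fun _ => α) ω (t + 1)‖ ^ 2 -
            ‖P.dualIter orc 0 (fun _ => α) ω t‖ ^ 2), Finset.sum_range_sub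
            (fun t => ‖P.dualIter orc 0 (fun _ => α) ω t‖ ^ 2), dualIter_zero]
          simp
        _ ≤ _ := by
          refine Finset.sum_le_sum fun t _ => ?_
          have := norm_sq_step_sub_le (α := α) hG (P.dualIter orc 0 (fun _ => α) ω t) 0
            (fun j => le_rfl) (ω t)
          rw [dualIter_succ, real_inner_comm]
          simp only [sub_zero] at this
          linarith
    rw [Finset.sum_add_distrib, ← Finset.mul_sum, Finset.sum_const, Finset.card_univ,
      Fintype.card_fin, nsmul_eq_mul] at h1
    have h2 : ((T - 1 : ℕ) : ℝ) * (α ^ 2 * G ^ 2) ≤ T * (α ^ 2 * G ^ 2) := by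
      gcongr
      omega
    refine le_of_mul_le_mul_left ?_ (mul_pos two_pos h0)
    nlinarith

/-- The martingale part of the sampled objective values. -/
lemma IsDualSolution.expect_abs_sum_lag_sub_le [NeZero N] {lamStar : E m}
    (hd : P.IsDualSolution lamStar) (ho : P.IsOracle orc)
    (hG : ∀ i lam, ‖P.sgrad orc i lam‖ ≤ G) {H R : ℝ}
    (hH : ∀ i, ∀ x ∈ P.X i, |P.h i x| ≤ H) (hα : 0 ≤ α)
    (hR : 4 * ‖lamStar‖ ^ 2 + 2 * (T * (α ^ 2 * G ^ 2)) ≤ R) :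
    𝔼 ω : Fin (T - 1) → Fin N, |∑ t : Fin (T - 1),
        (P.lag orc (ω t) (P.dualIter orc 0 (fun _ => α) ω t) -
          P.dual (P.dualIter orc 0 (fun _ => α) ω t))| ≤
      √(T * (2 * H ^ 2 + 2 * G ^ 2 * R)) := by
  have hR0 : 0 ≤ R := le_trans (by positivity) hR
  apply expect_abs_le_of_expect_sq_le
  have key := expect_sum_sq_le (n := T - 1) (κ := Fin N)
    (fun t ω => P.lag orc (ω t) (P.dualIter orc 0 (fun _ => α) ω t) -
          P.dual (P.dualIter orc 0 (fun _ => α) ω t)) (B := 2 * H ^ 2 + 2 * G ^ 2 * R) ?_ ?_ ?_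
  · refine key.trans ?_
    gcongr
    omega
  · intro s t hst ω i
    simp only [dualIter_update ω t i s hst.le, Function.update_of_ne hst.ne]
  · intro t ω
    simp only [dualIter_update ω t _ t le_rfl, Function.update_self]
    rw [Finset.expect_sub_distrib, ← ho.dual_eq NeZero.one_le, Fintype.expect_const, sub_self]
  · intro t
    rw [expect_draw t (fun i lam => (P.lag orc i lam - P.dual lam) ^ 2)]
    -- Since `d(λ)` is the mean of the terms `lag`, this is a conditional variance, bounded by the
    -- second moment.
    have h1 : ∀ lam : E m, 𝔼 i, (P.lag orc i lam - P.dual lam) ^ 2 ≤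
        2 * H ^ 2 + 2 * G ^ 2 * ‖lam‖ ^ 2 := by
      intro lam
      rw [ho.dual_eq NeZero.one_le]
      refine (expect_sub_expect_sq_le _).trans (Finset.expect_le Finset.univ_nonempty fun i _ => ?_)
      have h2 := sq_le_sq' (abs_le.1 (hH i _ (ho.mem_X i zero_le_one lam))).1
        (abs_le.1 (hH i _ (ho.mem_X i zero_le_one lam))).2
      have h3 : (inner ℝ lam (P.sgrad orc i lam)) ^ 2 ≤ G ^ 2 * ‖lam‖ ^ 2 := by
        have h4 := abs_real_inner_le_norm lam (P.sgrad orc i lam)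
        have h5 := h4.trans (mul_le_mul_of_nonneg_left (hG i lam) (norm_nonneg lam))
        have h6 := pow_le_pow_left₀ (abs_nonneg _) h5 2
        rw [sq_abs] at h6
        linarith [mul_pow ‖lam‖ G 2]
      rw [lag]
      nlinarith [sq_nonneg (P.h i (orc i 1 lam) - inner ℝ lam (P.sgrad orc i lam))]
    refine (Finset.expect_le_expect fun ω _ => h1 _).trans ?_
    simp only [Finset.expect_add_distrib, ← Finset.mul_expect, Fintype.expect_const]
    have := (hd.expect_norm_sq_le (T := T) ho hG hα t t.2.le).trans hR
    gcongr

end Stage1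

end Problem

end TwoStage

namespace TwoStage

/-! ### Block averages versus the ergodic average -/

section BlockAverage

variable {N n : ℕ}

lemma sum_blockIdx {V : Type*} [AddCommGroup V] (ω : Fin n → Fin N) (i : Fin N)
    (F : Option (Fin n) → V) :
    ∑ l : Option (Fin n) with ∀ t ∈ l, ω t = i, F l = F none + ∑ t with ω t = i, F (some t) := by
  rw [Finset.sum_filter, Fintype.sum_option, Finset.sum_filter]
  simp

lemma card_blockIdx (ω : Fin n → Fin N) (i : Fin N) :
    ((Finset.univ.filter fun l : Option (Fin n) => ∀ t ∈ l, ω t = i).card : ℝ) =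
      ((Finset.univ.filter fun t => ω t = i).card : ℝ) + 1 := by
  have := sum_blockIdx ω i (fun _ => (1 : ℝ))
  simp only [Finset.sum_const, nsmul_eq_mul, mul_one] at this
  rw [this, add_comm]

/-- The distance between the block averages and the ergodic average, relative to the size of the
averaged vectors. -/
noncomputable def blockDev (T : ℕ) (ω : Fin n → Fin N) : ℝ :=
  ∑ i, |T - N * (((Finset.univ.filter fun t => ω t = i).card : ℝ) + 1)| / (N * T) + N / T

lemma blockDev_nonneg (T : ℕ) (ω : Fin n → Fin N) : 0 ≤ blockDev T ω := by
  unfold blockDev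
  positivity

/-- With `c = I_i + 1`, an atom of block `i` has weight `1/(N c)` on one side and `1/T` on the
other, so the `c` atoms contribute at most `B |T - N c| / (N T)`. The atom `none` is absent from the
ergodic average; correcting for it costs `B/T` per block, hence the term `N/T` of `blockDev`. -/
lemma norm_blockAvg_sub_le {V : Type*} [NormedAddCommGroup V] [NormedSpace ℝ V]
    (hN : 1 ≤ N) {T : ℕ} (hT : 1 ≤ T) (ω : Fin n → Fin N) (u : Fin N → Option (Fin n) → V)
    {B : ℝ} (hu : ∀ i l, ‖u i l‖ ≤ B) :
    ‖∑ i, ∑ l : Option (Fin n) with ∀ t ∈ l, ω t = i,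
          (1 / (((Finset.univ.filter fun t => ω t = i).card : ℝ) + 1)) •
            ((1 / (N : ℝ)) • u i l) -
        (1 / (T : ℝ)) • ∑ t, u (ω t) (some t)‖ ≤ B * blockDev T ω := by
  have hN' : (0 : ℝ) < N := by positivity
  have hT' : (0 : ℝ) < T := by positivity
  have h1 : ∑ t, u (ω t) (some t) = ∑ i, (∑ l : Option (Fin n) with ∀ t ∈ l, ω t = i, u i l -
      u i none) := by
    rw [← Finset.sum_fiberwise Finset.univ ω]
    refine Finset.sum_congr rfl fun i _ => ?_
    rw [sum_blockIdx, add_sub_cancel_left]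
    refine Finset.sum_congr rfl fun t ht => ?_
    rw [(Finset.mem_filter.1 ht).2]
  rw [h1, Finset.smul_sum, ← Finset.sum_sub_distrib]
  have h2 : ∀ i, ∑ l : Option (Fin n) with ∀ t ∈ l, ω t = i,
          (1 / (((Finset.univ.filter fun t => ω t = i).card : ℝ) + 1)) •
            ((1 / (N : ℝ)) • u i l) -
        (1 / (T : ℝ)) • (∑ l : Option (Fin n) with ∀ t ∈ l, ω t = i, u i l - u i none) =
      ∑ l : Option (Fin n) with ∀ t ∈ l, ω t = i,
          (1 / (((Finset.univ.filter fun t => ω t = i).card : ℝ) + 1) * (1 / (N : ℝ)) -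
            1 / (T : ℝ)) • u i l + (1 / (T : ℝ)) • u i none := by
    intro i
    simp only [smul_sub, sub_smul, Finset.sum_sub_distrib, smul_smul, Finset.smul_sum]
    abel
  simp only [h2]
  have h3 : B * blockDev T ω = ∑ i : Fin N,
      ((((Finset.univ.filter fun t => ω t = i).card : ℝ) + 1) *
        (|1 / (((Finset.univ.filter fun t => ω t = i).card : ℝ) + 1) * (1 / (N : ℝ)) -
            1 / (T : ℝ)| * B) + 1 / (T : ℝ) * B) := by
    rw [blockDev, Finset.sum_add_distrib, mul_add, Finset.mul_sum]
    congr 1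
    · refine Finset.sum_congr rfl fun i _ => ?_
      set c : ℝ := ((Finset.univ.filter fun t => ω t = i).card : ℝ) + 1 with hc
      have hc' : 0 < c := by positivity
      have h4 : 1 / c * (1 / (N : ℝ)) - 1 / (T : ℝ) = (T - N * c) / (c * (N * T)) := by
        field_simp
      rw [h4, abs_div, abs_of_pos (show 0 < c * (N * T) by positivity)]
      field_simp
    · simp
      ring
  rw [h3]
  refine (norm_sum_le _ _).trans (Finset.sum_le_sum fun i _ => ?_)
  refine (norm_add_le _ _).trans (add_le_add ?_ ?_)
  · refine (norm_sum_le _ _).trans ?_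
    rw [← card_blockIdx ω i, ← nsmul_eq_mul]
    refine Finset.sum_le_card_nsmul _ _ _ fun l _ => ?_
    rw [norm_smul, Real.norm_eq_abs]
    exact mul_le_mul_of_nonneg_left (hu i l) (abs_nonneg _)
  · rw [norm_smul, Real.norm_of_nonneg (by positivity)]
    exact mul_le_mul_of_nonneg_left (hu i none) (by positivity)

/-- Each draw contributes `N` times an indicator, of mean `1` and second moment `N`. The centered
contributions are independent, so their sum has second moment at most `n N`. -/
lemma expect_abs_count_le [NeZero N] (i : Fin N) :
    𝔼 ω : Fin n → Fin N, |N * ((Finset.univ.filter fun t => ω t = i).card : ℝ) - n| ≤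
      √(n * N) := by
  have hN' : (N : ℝ) ≠ 0 := NeZero.ne _
  set f : Fin N → ℝ := fun j => if j = i then N else 0 with hf
  have hmean : 𝔼 j, f j = 1 := by
    rw [Fintype.expect_eq_sum_div_card]
    simp [hf, hN']
  have hsq : 𝔼 j, f j ^ 2 = N := by
    rw [Fintype.expect_eq_sum_div_card]
    simp only [hf, ite_pow, Finset.sum_ite_eq', Finset.mem_univ, if_true, Fintype.card_fin,
      ne_eq, OfNat.ofNat_ne_zero, not_false_eq_true, zero_pow]
    field_simp
  have hsum : ∀ ω : Fin n → Fin N,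
      N * ((Finset.univ.filter fun t => ω t = i).card : ℝ) - n = ∑ t, (f (ω t) - 1) := by
    intro ω
    simp [hf, ← Finset.sum_filter, mul_comm]
  simp only [hsum]
  apply expect_abs_le_of_expect_sq_le
  refine expect_sum_sq_le (fun t ω => f (ω t) - 1) ?_ ?_ ?_
  · intro s t hst ω j
    simp [Function.update_of_ne hst.ne]
  · intro t ω
    simp only [Function.update_self, Finset.expect_sub_distrib, Fintype.expect_const, hmean,
      sub_self]
  · intro t
    rw [← expect_update t]
    simp only [Function.update_self, Fintype.expect_const]
    have := expect_sub_expect_sq_le f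
    rwa [hmean, hsq] at this

/-- In absolute value, `T - N (I_i + 1)` exceeds the fluctuation `N I_i - (T - 1)` by at most `N -
1`, which produces one of the two terms `N/T`. -/
lemma expect_blockDev_le [NeZero N] {T : ℕ} (hT : 1 ≤ T) :
    𝔼 ω : Fin (T - 1) → Fin N, blockDev T ω ≤ √((N : ℝ) / T) + 2 * (N / T) := by
  have hN' : (0 : ℝ) < N := by exact_mod_cast Nat.pos_of_ne_zero (NeZero.ne N)
  have hN1 : (1 : ℝ) ≤ N := by exact_mod_cast (NeZero.one_le : 1 ≤ N)
  have hT' : (0 : ℝ) < T := by positivity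
  have h1 : ∀ i : Fin N, 𝔼 ω : Fin (T - 1) → Fin N,
      |T - N * (((Finset.univ.filter fun t => ω t = i).card : ℝ) + 1)| / (N * T) ≤
        (√(T * N) + N) / (N * T) := by
    intro i
    rw [← Finset.expect_div]
    gcongr
    have h2 : 𝔼 ω : Fin (T - 1) → Fin N,
        |T - N * (((Finset.univ.filter fun t => ω t = i).card : ℝ) + 1)| ≤
        𝔼 ω : Fin (T - 1) → Fin N,
        (|N * ((Finset.univ.filter fun t => ω t = i).card : ℝ) - (T - 1 : ℕ)| + N) := by
      refine Finset.expect_le_expect fun ω _ => ?_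
      rw [abs_le, Nat.cast_sub hT, Nat.cast_one]
      set c : ℝ := N * ((Finset.univ.filter fun t => ω t = i).card : ℝ)
      have := neg_abs_le (c - (T - 1))
      have := le_abs_self (c - (T - 1))
      constructor <;> linarith
    rw [Finset.expect_add_distrib, Fintype.expect_const] at h2
    refine h2.trans (add_le_add_left ((expect_abs_count_le i).trans ?_) _)
    gcongr
    omega
  have h3 : 𝔼 ω : Fin (T - 1) → Fin N, blockDev T ω ≤
      ∑ _i : Fin N, (√(T * N) + N) / (N * T) + N / T := by
    simp only [blockDev, Finset.expect_add_distrib, Fintype.expect_const, Finset.expect_sum_comm]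
    exact add_le_add_left (Finset.sum_le_sum fun i _ => h1 i) _
  refine h3.trans (le_of_eq ?_)
  have h4 : √((N : ℝ) / T) = √(T * N) / T := by
    rw [show (N : ℝ) / T = (T * N) / T ^ 2 by field_simp, Real.sqrt_div (by positivity),
      Real.sqrt_sq hT'.le]
  rw [h4, Finset.sum_const, Finset.card_univ, Fintype.card_fin, nsmul_eq_mul]
  field_simp
  ring

end BlockAverage

namespace Problem

variable {N m : ℕ} {d : Fin N → ℕ} {P : Problem N m d} {orc : ∀ i, ℝ → E m → E (d i)}

/-! ### Starting points of the second stage -/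

variable (P) in
/-- Starting blocks which are convex combinations of points of `X_i` at which `f_i = f_i^{**}`. -/
structure ValidStart {ι : Type} (s : Start d ι) : Prop where
  wt_nonneg : ∀ i l, 0 ≤ s.wt i l
  sum_wt : ∀ i, ∑ l ∈ s.Q i, s.wt i l = 1
  mem_X : ∀ i l, s.pt i l ∈ P.X i
  val_eq : ∀ i l, P.val i (s.pt i l) = P.h i (s.pt i l)

variable (P) in
/-- Twice the Frank-Wolfe objective `½ (β - d̄)_+² + ½ ‖[z - b]_+‖²`. -/
noncomputable def merit (dbar : ℝ) (s : (Fin N → ℝ) × (Fin N → E m)) : ℝ :=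
  max (∑ i, s.1 i - dbar) 0 ^ 2 + ‖projPos (∑ i, s.2 i - P.b)‖ ^ 2

lemma merit_nonneg (dbar : ℝ) (s : (Fin N → ℝ) × (Fin N → E m)) : 0 ≤ P.merit dbar s := by
  unfold merit
  positivity

lemma sqrt_merit_le (dbar : ℝ) (s : (Fin N → ℝ) × (Fin N → E m)) :
    √(P.merit dbar s) ≤ max (∑ i, s.1 i - dbar) 0 + ‖projPos (∑ i, s.2 i - P.b)‖ := by
  rw [Real.sqrt_le_left (by positivity), merit]
  have := mul_nonneg (le_max_right (∑ i, s.1 i - dbar) 0) (norm_nonneg (projPos (∑ i, s.2 i - P.b)))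
  nlinarith

lemma sub_le_sqrt_merit (dbar : ℝ) (s : (Fin N → ℝ) × (Fin N → E m)) :
    ∑ i, s.1 i - dbar ≤ √(P.merit dbar s) :=
  (le_max_left _ 0).trans <| Real.le_sqrt_of_sq_le <| by
    unfold merit
    nlinarith [sq_nonneg ‖projPos (∑ i, s.2 i - P.b)‖]

lemma apply_le_sqrt_merit (dbar : ℝ) (s : (Fin N → ℝ) × (Fin N → E m)) (j : Fin m) :
    (∑ i, s.2 i - P.b) j ≤ √(P.merit dbar s) :=
  (apply_le_norm_projPos _ j).trans <| Real.le_sqrt_of_sq_le <| by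
    unfold merit
    nlinarith [sq_nonneg (max (∑ i, s.1 i - dbar) 0)]

namespace ValidStart

variable {ι : Type} {s : Start d ι}

lemma beta0_sub (hs : P.ValidStart s) (i : Fin N) (a : ℝ) :
    P.beta0 s i - 1 / (N : ℝ) * a =
      ∑ l ∈ s.Q i, s.wt i l * (1 / (N : ℝ) * (P.val i (s.pt i l) - a)) := by
  simp only [beta0, mul_sub, Finset.sum_sub_distrib]
  rw [← Finset.sum_mul, hs.sum_wt, one_mul]

lemma z0_sub (hs : P.ValidStart s) (i : Fin N) (a : E m) :
    P.z0 s i - (1 / (N : ℝ)) • a =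
      ∑ l ∈ s.Q i, s.wt i l • ((1 / (N : ℝ)) • (P.act i (s.pt i l) - a)) := by
  simp only [z0, smul_sub, Finset.sum_sub_distrib]
  rw [← Finset.sum_smul, hs.sum_wt, one_smul]

lemma sum_beta0_sub (hs : P.ValidStart s) (hN : 1 ≤ N) (a : ℝ) :
    ∑ i, P.beta0 s i - a =
      ∑ i, ∑ l ∈ s.Q i, s.wt i l * (1 / (N : ℝ) * (P.val i (s.pt i l) - a)) := by
  have hN' : (N : ℝ) ≠ 0 := by positivity
  simp only [← hs.beta0_sub, Finset.sum_sub_distrib, Finset.sum_const, Finset.card_univ,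
    Fintype.card_fin, nsmul_eq_mul]
  field_simp

lemma sum_sub_eq (hN : 1 ≤ N) (v : Fin N → E m) (a : E m) :
    ∑ i, v i - a = ∑ i, (v i - (1 / (N : ℝ)) • a) := by
  have hN' : (N : ℝ) ≠ 0 := by positivity
  simp only [Finset.sum_sub_distrib, Finset.sum_const, Finset.card_univ,
    Fintype.card_fin, ← Nat.cast_smul_eq_nsmul ℝ, smul_smul, mul_one_div_cancel hN', one_smul]

lemma sum_z0_sub (hs : P.ValidStart s) (hN : 1 ≤ N) (a : E m) :
    ∑ i, P.z0 s i - a =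
      ∑ i, ∑ l ∈ s.Q i, s.wt i l • ((1 / (N : ℝ)) • (P.act i (s.pt i l) - a)) := by
  rw [sum_sub_eq hN]
  exact Finset.sum_congr rfl fun i _ => hs.z0_sub i a

lemma abs_beta0_le (hs : P.ValidStart s) {H : ℝ} (hH : ∀ i, ∀ x ∈ P.X i, |P.h i x| ≤ H)
    (i : Fin N) : |P.beta0 s i| ≤ 1 / (N : ℝ) * H := by
  calc |P.beta0 s i| ≤ ∑ l ∈ s.Q i, s.wt i l * (1 / (N : ℝ) * H) := by
        refine (Finset.abs_sum_le_sum_abs _ _).trans (Finset.sum_le_sum fun l _ => ?_)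
        rw [abs_mul, abs_mul, abs_of_nonneg (hs.wt_nonneg i l),
          abs_of_nonneg (show (0 : ℝ) ≤ 1 / N by positivity), hs.val_eq]
        have := hH i _ (hs.mem_X i l)
        have := hs.wt_nonneg i l
        gcongr
    _ = 1 / (N : ℝ) * H := by rw [← Finset.sum_mul, hs.sum_wt, one_mul]

lemma norm_z0_sub_le (hs : P.ValidStart s) {G : ℝ}
    (hG : ∀ i, ∀ x ∈ P.X i, ‖P.act i x - P.b‖ ≤ G) (i : Fin N) :
    ‖P.z0 s i - (1 / (N : ℝ)) • P.b‖ ≤ 1 / (N : ℝ) * G := by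
  rw [hs.z0_sub]
  calc _ ≤ ∑ l ∈ s.Q i, s.wt i l * (1 / (N : ℝ) * G) := by
        refine (norm_sum_le _ _).trans (Finset.sum_le_sum fun l _ => ?_)
        rw [norm_smul, norm_smul, Real.norm_of_nonneg (hs.wt_nonneg i l),
          Real.norm_of_nonneg (show (0 : ℝ) ≤ 1 / N by positivity)]
        have := hG i _ (hs.mem_X i l)
        have := hs.wt_nonneg i l
        gcongr
    _ = 1 / (N : ℝ) * G := by rw [← Finset.sum_mul, hs.sum_wt, one_mul]

/-- A start at arbitrary points. -/
lemma sqrt_merit_le (hs : P.ValidStart s) (hN : 1 ≤ N) {G H : ℝ}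
    (hG : ∀ i, ∀ x ∈ P.X i, ‖P.act i x - P.b‖ ≤ G) (hH : ∀ i, ∀ x ∈ P.X i, |P.h i x| ≤ H)
    {dstar dbar : ℝ} (hdstar : |dstar| ≤ H) (hdbar : dbar ≤ dstar) :
    √(P.merit dbar (P.beta0 s, P.z0 s)) ≤ 2 * H + G + (dstar - dbar) := by
  have hN' : (N : ℝ) ≠ 0 := by positivity
  have h1 : ∑ i, P.beta0 s i ≤ H := by
    calc ∑ i, P.beta0 s i ≤ ∑ _i : Fin N, 1 / (N : ℝ) * H :=
          Finset.sum_le_sum fun i _ => (le_abs_self _).trans (hs.abs_beta0_le hH i)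
      _ = H := by
        simp only [Finset.sum_const, Finset.card_univ, Fintype.card_fin, nsmul_eq_mul]
        field_simp
  have h2 : ‖∑ i, P.z0 s i - P.b‖ ≤ G := by
    rw [sum_sub_eq hN]
    calc _ ≤ ∑ _i : Fin N, 1 / (N : ℝ) * G :=
          (norm_sum_le _ _).trans (Finset.sum_le_sum fun i _ => hs.norm_z0_sub_le hG i)
      _ = G := by
        simp only [Finset.sum_const, Finset.card_univ, Fintype.card_fin, nsmul_eq_mul]
        field_simp
  refine (Problem.sqrt_merit_le _ _).trans ?_
  have h4 := norm_projPos_le (∑ i, P.z0 s i - P.b)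
  have h5 : max (∑ i, P.beta0 s i - dbar) 0 ≤ 2 * H + (dstar - dbar) := by
    have := abs_le.1 hdstar
    exact max_le (by linarith) (by linarith [(abs_nonneg dstar).trans hdstar])
  dsimp only
  linarith

end ValidStart

lemma validStart_pointStart {x0 : ∀ i, E (d i)}
    (hx0 : ∀ i, x0 i ∈ dom (P.f i) ∧ P.f i (x0 i) = biconj (P.f i) (x0 i)) :
    P.ValidStart (pointStart x0) where
  wt_nonneg _ _ := zero_le_one
  sum_wt i := by simp [pointStart]
  mem_X i _ := subset_X i (hx0 i).1
  val_eq i _ := by simp only [pointStart, val, h, (hx0 i).2]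

section Averaged

variable {T : ℕ} {α : ℝ}

lemma IsOracle.validStart_averagedStart (ho : P.IsOracle orc) (ω : Fin (T - 1) → Fin N) :
    P.ValidStart (P.averagedStart orc 0 (fun _ => α) ω) where
  wt_nonneg i l := by
    simp only [averagedStart]
    positivity
  sum_wt i := by
    simp only [averagedStart, Finset.sum_const, nsmul_eq_mul]
    rw [card_blockIdx]
    exact mul_one_div_cancel (by positivity)
  mem_X i l := by cases l <;> exact ho.mem_X i zero_le_one _
  val_eq i l := by cases l <;> exact ho.val_eq i zero_le_one _

variable {G H : ℝ}

/-- The start from the averages of the oracle outputs of the first stage. -/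
lemma IsDualSolution.sqrt_merit_averagedStart_le [NeZero N] {lamStar : E m}
    (hd : P.IsDualSolution lamStar) (ho : P.IsOracle orc) (hT : 1 ≤ T)
    (hG : ∀ i, ∀ x ∈ P.X i, ‖P.act i x - P.b‖ ≤ G)
    (hH : ∀ i, ∀ x ∈ P.X i, |P.h i x| ≤ H) (hα : 0 ≤ α) (hαG : α = 0 → G = 0)
    (ω : Fin (T - 1) → Fin N) {dbar : ℝ} (hdbar : dbar ≤ P.dual lamStar) :
    √(P.merit dbar (P.beta0 (P.averagedStart orc 0 (fun _ => α) ω),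
        P.z0 (P.averagedStart orc 0 (fun _ => α) ω))) ≤
      |∑ t : Fin (T - 1), (P.lag orc (ω t) (P.dualIter orc 0 (fun _ => α) ω t) -
          P.dual (P.dualIter orc 0 (fun _ => α) ω t))| / T + α * G ^ 2 / 2 +
        (P.dual lamStar - dbar) +
        ‖P.dualIter orc 0 (fun _ => α) ω (T - 1)‖ / α / T + (2 * H + G) * blockDev T ω := by
  have hN : 1 ≤ N := NeZero.one_le
  have hT' : (0 : ℝ) < T := by positivity
  have hs := ho.validStart_averagedStart (α := α) ω
  have hg : ∀ i lam, ‖P.sgrad orc i lam‖ ≤ G := fun i lam => hG i _ (ho.mem_X i zero_le_one lam)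
  set dstar := P.dual lamStar with hdstar
  have hds : |dstar| ≤ H := hd.abs_dual_le hN hH
  set s := P.averagedStart orc 0 (fun _ => α) ω with hsdef
  set M := ∑ t : Fin (T - 1), (P.lag orc (ω t) (P.dualIter orc 0 (fun _ => α) ω t) -
          P.dual (P.dualIter orc 0 (fun _ => α) ω t)) with hM
  have hz : ‖projPos (∑ i, P.z0 s i - P.b)‖ ≤
      ‖P.dualIter orc 0 (fun _ => α) ω (T - 1)‖ / α / T + G * blockDev T ω := by
    have h1 := norm_blockAvg_sub_le hN hT ω (fun i l => P.act i (s.pt i l) - P.b)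
      (fun i l => hG i _ (hs.mem_X i l))
    have h2 := hs.sum_z0_sub hN P.b
    have h3 := norm_projPos_add_le ((1 / (T : ℝ)) • ∑ t, (P.act (ω t) (s.pt (ω t) (some t)) - P.b))
      (∑ i, P.z0 s i - P.b - (1 / (T : ℝ)) • ∑ t, (P.act (ω t) (s.pt (ω t) (some t)) - P.b))
    rw [add_sub_cancel] at h3
    refine h3.trans (add_le_add ?_ (by rw [h2]; exact h1))
    have h4 := norm_projPos_sum_sgrad_le hg hα hαG ω
    have h5 : ∀ v : E m, projPos ((1 / (T : ℝ)) • v) = (1 / (T : ℝ)) • projPos v := by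
      intro v
      ext j
      simp only [projPos_apply, PiLp.smul_apply, smul_eq_mul]
      rw [mul_max_of_nonneg _ _ (by positivity), mul_zero]
    rw [h5, norm_smul, Real.norm_of_nonneg (by positivity), one_div, ← div_eq_inv_mul]
    exact div_le_div_of_nonneg_right h4 hT'.le
  have hb : ∑ i, P.beta0 s i - dstar ≤ |M| / T + α * G ^ 2 / 2 + 2 * H * blockDev T ω := by
    have h1 := norm_blockAvg_sub_le hN hT ω (fun i l => P.val i (s.pt i l) - dstar)
      (B := 2 * H) (fun i l => by
        rw [hs.val_eq, Real.norm_eq_abs]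
        have := abs_sub (P.h i (s.pt i l)) dstar
        have := hH i _ (hs.mem_X i l)
        linarith)
    have h2 := hs.sum_beta0_sub hN dstar
    have h3 := (le_abs_self _).trans h1
    simp only [smul_eq_mul] at h3
    have h4 : ∑ t, (P.val (ω t) (s.pt (ω t) (some t)) - dstar) ≤
        |M| + T * (α * G ^ 2 / 2) := by
      -- Here `d(λ_t) ≤ d*` replaces `d*` by the conditional mean of `lag`, which makes the sum a
      -- martingale up to the inner products.
      have h5 : ∀ t : Fin (T - 1), P.val (ω t) (s.pt (ω t) (some t)) - dstar ≤
          (P.lag orc (ω t) (P.dualIter orc 0 (fun _ => α) ω t) -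
            P.dual (P.dualIter orc 0 (fun _ => α) ω t)) -
          inner ℝ (P.dualIter orc 0 (fun _ => α) ω t)
            (P.sgrad orc (ω t) (P.dualIter orc 0 (fun _ => α) ω t)) := by
        intro t
        have := hd.isMax _ (dualIter_nonneg (P := P) (orc := orc) (α := α) ω t)
        rw [hs.val_eq, lag]
        change P.h (ω t) (orc (ω t) 1 (P.dualIter orc 0 (fun _ => α) ω t)) - dstar ≤ _
        linarith
      have h6 : ∑ t, (P.val (ω t) (s.pt (ω t) (some t)) - dstar) ≤
          M - ∑ t : Fin (T - 1), inner ℝ (P.dualIter orc 0 (fun _ => α) ω t)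
            (P.sgrad orc (ω t) (P.dualIter orc 0 (fun _ => α) ω t)) := by
        rw [hM, ← Finset.sum_sub_distrib]
        exact Finset.sum_le_sum fun t _ => h5 t
      have h7 := neg_sum_inner_sgrad_le hg hα hαG ω
      have h8 := le_abs_self M
      linarith
    have h9 : 1 / (T : ℝ) * ∑ t, (P.val (ω t) (s.pt (ω t) (some t)) - dstar) ≤
        |M| / T + α * G ^ 2 / 2 := by
      rw [one_div, inv_mul_le_iff₀ hT', mul_add, mul_div_cancel₀ _ hT'.ne']
      exact h4
    rw [h2]
    have h10 : ∑ i, ∑ l ∈ s.Q i, s.wt i l * (1 / (N : ℝ) * (P.val i (s.pt i l) - dstar)) -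
        1 / (T : ℝ) * ∑ t, (P.val (ω t) (s.pt (ω t) (some t)) - dstar) ≤ 2 * H * blockDev T ω := h3
    linarith
  refine (sqrt_merit_le _ _).trans ?_
  have hH0 : 0 ≤ H := (abs_nonneg _).trans hds
  have h0 : 0 ≤ |M| / T + α * G ^ 2 / 2 + 2 * H * blockDev T ω := by
    have := blockDev_nonneg T ω
    positivity
  have hmax : max (∑ i, P.beta0 s i - dbar) 0 ≤
      |M| / T + α * G ^ 2 / 2 + 2 * H * blockDev T ω + (dstar - dbar) :=
    max_le (by linarith) (by linarith)
  dsimp only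
  linarith

end Averaged

end Problem

end TwoStage

namespace TwoStage

namespace Problem

variable {N m : ℕ} {d : Fin N → ℕ} {P : Problem N m d} {orc : ∀ i, ℝ → E m → E (d i)}

/-! ### Block-coordinate Frank-Wolfe -/

section Stage2

variable (P orc) in
/-- One iteration on block `i` with stepsize `r`. -/
noncomputable def fwStep (dbar r : ℝ) (s : (Fin N → ℝ) × (Fin N → E m)) (i : Fin N) :
    (Fin N → ℝ) × (Fin N → E m) :=
  (Function.update s.1 i
      ((1 - r) * s.1 i + r * (1 / (N : ℝ) * P.val i (P.fwPoint orc dbar s i))),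
    Function.update s.2 i
      ((1 - r) • s.2 i + r • ((1 / (N : ℝ)) • P.act i (P.fwPoint orc dbar s i))))

variable {K : ℕ} {dbar : ℝ} {ρ : ℕ → ℝ} {s₀ : (Fin N → ℝ) × (Fin N → E m)}

lemma bcfw_succ (ω : Fin K → Fin N) (k : Fin K) :
    P.bcfw orc dbar ρ ω s₀ (k + 1) =
      P.fwStep orc dbar (ρ k) (P.bcfw orc dbar ρ ω s₀ k) (ω k) := by
  rw [bcfw]
  simp [fwStep]

lemma bcfw_update (ω : Fin K → Fin N) (k : Fin K) (i : Fin N) (s : ℕ) (hs : s ≤ k) :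
    P.bcfw orc dbar ρ (Function.update ω k i) s₀ s = P.bcfw orc dbar ρ ω s₀ s := by
  induction s with
  | zero => rfl
  | succ s ih =>
    have hlt : s < K := lt_of_lt_of_le hs k.2.le
    have hne : (⟨s, hlt⟩ : Fin K) ≠ k := fun h => by
      rw [← h] at hs; simp at hs
    have h1 := bcfw_succ (P := P) (orc := orc) (dbar := dbar) (ρ := ρ) (s₀ := s₀)
      (Function.update ω k i) ⟨s, hlt⟩
    have h2 := bcfw_succ (P := P) (orc := orc) (dbar := dbar) (ρ := ρ) (s₀ := s₀) ω ⟨s, hlt⟩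
    simp only [Function.update_of_ne hne] at h1 h2
    rw [h1, h2, ih (by omega)]

variable (P) in
/-- Blocks of the size of `(1/N) (f_i^{**}(x), A_i x)`, `x ∈ X_i`. -/
structure BlockBound (G H : ℝ) (s : (Fin N → ℝ) × (Fin N → E m)) : Prop where
  fst : ∀ i, |s.1 i| ≤ 1 / (N : ℝ) * H
  snd : ∀ i, ‖s.2 i - (1 / (N : ℝ)) • P.b‖ ≤ 1 / (N : ℝ) * G

variable {G H : ℝ}

lemma IsOracle.fwPoint_mem_X (ho : P.IsOracle orc) (s : (Fin N → ℝ) × (Fin N → E m))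
    (i : Fin N) : P.fwPoint orc dbar s i ∈ P.X i :=
  ho.mem_X i (le_max_right _ _) _

lemma IsOracle.abs_fwPoint_le (ho : P.IsOracle orc) (hH : ∀ i, ∀ x ∈ P.X i, |P.h i x| ≤ H)
    (s : (Fin N → ℝ) × (Fin N → E m)) (i : Fin N) :
    |1 / (N : ℝ) * P.val i (P.fwPoint orc dbar s i)| ≤ 1 / (N : ℝ) * H := by
  rw [abs_mul, abs_of_nonneg (show (0 : ℝ) ≤ 1 / N by positivity), fwPoint,
    ho.val_eq i (le_max_right _ _)]
  have := hH i _ (ho.fwPoint_mem_X (dbar := dbar) s i)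
  rw [fwPoint] at this
  gcongr

lemma IsOracle.norm_fwPoint_le (ho : P.IsOracle orc)
    (hG : ∀ i, ∀ x ∈ P.X i, ‖P.act i x - P.b‖ ≤ G)
    (s : (Fin N → ℝ) × (Fin N → E m)) (i : Fin N) :
    ‖(1 / (N : ℝ)) • P.act i (P.fwPoint orc dbar s i) - (1 / (N : ℝ)) • P.b‖ ≤
      1 / (N : ℝ) * G := by
  rw [← smul_sub, norm_smul, Real.norm_of_nonneg (by positivity)]
  have := hG i _ (ho.fwPoint_mem_X (dbar := dbar) s i)
  gcongr

/-- The updated block is a convex combination of two points of the same ball, as `0 ≤ r ≤ 1`. The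
bound keeps the curvature term of order `1/N²` along the whole run. -/
lemma BlockBound.fwStep (ho : P.IsOracle orc)
    (hG : ∀ i, ∀ x ∈ P.X i, ‖P.act i x - P.b‖ ≤ G) (hH : ∀ i, ∀ x ∈ P.X i, |P.h i x| ≤ H)
    {s : (Fin N → ℝ) × (Fin N → E m)} (hs : P.BlockBound G H s) {r : ℝ} (h0 : 0 ≤ r)
    (h1 : r ≤ 1) (i : Fin N) : P.BlockBound G H (P.fwStep orc dbar r s i) where
  fst j := by
    simp only [Problem.fwStep]
    rcases eq_or_ne j i with rfl | hij
    · rw [Function.update_self]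
      refine (abs_add_le _ _).trans ?_
      rw [abs_mul, abs_mul, abs_of_nonneg h0, abs_of_nonneg (sub_nonneg.2 h1)]
      have := mul_le_mul_of_nonneg_left (hs.fst j) (sub_nonneg.2 h1)
      have := mul_le_mul_of_nonneg_left (ho.abs_fwPoint_le (dbar := dbar) hH s j) h0
      linarith
    · rw [Function.update_of_ne hij]
      exact hs.fst j
  snd j := by
    simp only [Problem.fwStep]
    rcases eq_or_ne j i with rfl | hij
    · rw [Function.update_self]
      have h2 : ∀ x y c : E m, (1 - r) • x + r • y - c = (1 - r) • (x - c) + r • (y - c) := by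
        intro x y c
        module
      rw [h2]
      refine (norm_add_le _ _).trans ?_
      rw [norm_smul, norm_smul, Real.norm_of_nonneg h0, Real.norm_of_nonneg (sub_nonneg.2 h1)]
      have := mul_le_mul_of_nonneg_left (hs.snd j) (sub_nonneg.2 h1)
      have := mul_le_mul_of_nonneg_left (ho.norm_fwPoint_le (dbar := dbar) hG s j) h0
      linarith
    · rw [Function.update_of_ne hij]
      exact hs.snd j

lemma BlockBound.bcfw (ho : P.IsOracle orc)
    (hG : ∀ i, ∀ x ∈ P.X i, ‖P.act i x - P.b‖ ≤ G) (hH : ∀ i, ∀ x ∈ P.X i, |P.h i x| ≤ H)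
    (hs : P.BlockBound G H s₀) (h0 : ∀ k, 0 ≤ ρ k) (h1 : ∀ k, ρ k ≤ 1) (ω : Fin K → Fin N)
    (k : ℕ) (hk : k ≤ K) : P.BlockBound G H (P.bcfw orc dbar ρ ω s₀ k) := by
  induction k with
  | zero => exact hs
  | succ k ih =>
    have := bcfw_succ (P := P) (orc := orc) (dbar := dbar) (ρ := ρ) (s₀ := s₀) ω ⟨k, hk⟩
    simp only at this
    rw [this]
    exact (ih (by omega)).fwStep ho hG hH (h0 k) (h1 k) _

lemma sum_update_eq {V : Type*} [AddCommGroup V] (f : Fin N → V) (i : Fin N) (y : V) :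
    ∑ j, Function.update f i y j = ∑ j, f j + (y - f i) := by
  rw [Finset.sum_update_of_mem (Finset.mem_univ i), ← Finset.erase_eq,
    ← Finset.add_sum_erase _ f (Finset.mem_univ i)]
  abel

/-- Descent along one block; the objective has gradient `((β - d̄)_+, [z - b]_+)`. -/
lemma IsOracle.merit_fwStep_le (ho : P.IsOracle orc)
    (hG : ∀ i, ∀ x ∈ P.X i, ‖P.act i x - P.b‖ ≤ G) (hH : ∀ i, ∀ x ∈ P.X i, |P.h i x| ≤ H)
    {s : (Fin N → ℝ) × (Fin N → E m)} (hs : P.BlockBound G H s) (r : ℝ) (i : Fin N) :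
    P.merit dbar (P.fwStep orc dbar r s i) ≤ P.merit dbar s +
      2 * (r * (max (∑ j, s.1 j - dbar) 0 *
          (1 / (N : ℝ) * P.h i (P.fwPoint orc dbar s i) - s.1 i) +
        inner ℝ (projPos (∑ j, s.2 j - P.b))
          ((1 / (N : ℝ)) • P.act i (P.fwPoint orc dbar s i) - s.2 i))) +
      r ^ 2 * (4 * H ^ 2 + 4 * G ^ 2) / N ^ 2 := by
  have hv : P.val i (P.fwPoint orc dbar s i) = P.h i (P.fwPoint orc dbar s i) :=
    ho.val_eq i (le_max_right _ _) _
  set x := P.fwPoint orc dbar s i with hx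
  have hb : ∑ j, (P.fwStep orc dbar r s i).1 j =
      ∑ j, s.1 j + r * (1 / (N : ℝ) * P.h i x - s.1 i) := by
    rw [fwStep, sum_update_eq, hv]
    ring
  have hz : ∑ j, (P.fwStep orc dbar r s i).2 j =
      ∑ j, s.2 j + r • ((1 / (N : ℝ)) • P.act i x - s.2 i) := by
    rw [fwStep, sum_update_eq]
    congr 1
    module
  have h1 := sq_max_add_le (∑ j, s.1 j - dbar) (r * (1 / (N : ℝ) * P.h i x - s.1 i))
  have h2 := norm_sq_projPos_add_le (∑ j, s.2 j - P.b)
    (r • ((1 / (N : ℝ)) • P.act i x - s.2 i))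
  have h3 : |1 / (N : ℝ) * P.h i x - s.1 i| ≤ 2 * (1 / (N : ℝ) * H) := by
    have h4 := ho.abs_fwPoint_le (dbar := dbar) hH s i
    rw [← hx, hv] at h4
    have := abs_sub (1 / (N : ℝ) * P.h i x) (s.1 i)
    have := hs.fst i
    linarith
  have h4 : ‖(1 / (N : ℝ)) • P.act i x - s.2 i‖ ≤ 2 * (1 / (N : ℝ) * G) := by
    have h5 := ho.norm_fwPoint_le (dbar := dbar) hG s i
    rw [← hx] at h5
    have h6 := norm_sub_le ((1 / (N : ℝ)) • P.act i x - (1 / (N : ℝ)) • P.b)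
      (s.2 i - (1 / (N : ℝ)) • P.b)
    rw [sub_sub_sub_cancel_right] at h6
    have := hs.snd i
    linarith
  have h5 := pow_le_pow_left₀ (abs_nonneg _) h3 2
  have h6 := pow_le_pow_left₀ (norm_nonneg _) h4 2
  rw [sq_abs] at h5
  rw [norm_smul, mul_pow, Real.norm_eq_abs, sq_abs, inner_smul_right] at h2
  rw [merit, hb, hz, merit]
  have h7 : ∑ j, s.1 j + r * (1 / (N : ℝ) * P.h i x - s.1 i) - dbar =
    (∑ j, s.1 j - dbar) + r * (1 / (N : ℝ) * P.h i x - s.1 i) := by ring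
  have h8 : ∑ j, s.2 j + r • ((1 / (N : ℝ)) • P.act i x - s.2 i) - P.b =
    (∑ j, s.2 j - P.b) + r • ((1 / (N : ℝ)) • P.act i x - s.2 i) := by abel
  rw [h7, h8]
  have h9 := mul_le_mul_of_nonneg_left h5 (sq_nonneg r)
  have h10 := mul_le_mul_of_nonneg_left h6 (sq_nonneg r)
  have h11 : r ^ 2 * (4 * H ^ 2 + 4 * G ^ 2) / N ^ 2 =
      r ^ 2 * (2 * (1 / (N : ℝ) * H)) ^ 2 + r ^ 2 * (2 * (1 / (N : ℝ) * G)) ^ 2 := by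
    simp only [div_eq_mul_inv]
    ring
  rw [h11]
  linarith

/-- Expected descent, in comparison with a feasible point of the bidual problem. -/
lemma IsOracle.expect_merit_fwStep_le [NeZero N] (ho : P.IsOracle orc)
    (hG : ∀ i, ∀ x ∈ P.X i, ‖P.act i x - P.b‖ ≤ G) (hH : ∀ i, ∀ x ∈ P.X i, |P.h i x| ≤ H)
    {s : (Fin N → ℝ) × (Fin N → E m)} (hs : P.BlockBound G H s) {r : ℝ} (hr : 0 ≤ r)
    {y : ∀ i, E (d i)} (hy : P.BidualFeasible y) :
    𝔼 i, P.merit dbar (P.fwStep orc dbar r s i) ≤ P.merit dbar s +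
      r / N * (max ((1 / (N : ℝ)) * ∑ i, P.h i (y i) - dbar) 0 ^ 2 - P.merit dbar s) +
      r ^ 2 * (4 * H ^ 2 + 4 * G ^ 2) / N ^ 2 := by
  have hN' : (0 : ℝ) < N := by exact_mod_cast Nat.pos_of_ne_zero (NeZero.ne N)
  set g := max (∑ j, s.1 j - dbar) 0 with hg
  set w := projPos (∑ j, s.2 j - P.b) with hw
  set v := (1 / (N : ℝ)) * ∑ i, P.h i (y i) with hv
  set zy := (1 / (N : ℝ)) • ∑ i, P.act i (y i) with hzy
  have h1 := Finset.expect_le_expect (s := Finset.univ) fun i _ =>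
    ho.merit_fwStep_le (dbar := dbar) hG hH hs r i
  refine h1.trans ?_
  simp only [Finset.expect_add_distrib, Fintype.expect_const, ← Finset.mul_expect, ← hg, ← hw]
  -- The oracle point of each block beats `y i` for the linearized objective; the comparison is
  -- summed over blocks.
  have h2 : ∑ i, (g * (1 / (N : ℝ) * P.h i (P.fwPoint orc dbar s i) - s.1 i) +
        inner ℝ w ((1 / (N : ℝ)) • P.act i (P.fwPoint orc dbar s i) - s.2 i)) ≤
      g * (v - ∑ j, s.1 j) + inner ℝ w (zy - ∑ j, s.2 j) := by
    have h3 : g * (v - ∑ j, s.1 j) + inner ℝ w (zy - ∑ j, s.2 j) =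
        ∑ i, (g * (1 / (N : ℝ) * P.h i (y i) - s.1 i) +
          inner ℝ w ((1 / (N : ℝ)) • P.act i (y i) - s.2 i)) := by
      rw [Finset.sum_add_distrib, ← Finset.mul_sum, ← inner_sum, Finset.sum_sub_distrib,
        Finset.sum_sub_distrib, ← Finset.mul_sum, ← Finset.smul_sum]
    rw [h3]
    refine Finset.sum_le_sum fun i _ => ?_
    have h4 : g * P.h i (P.fwPoint orc dbar s i) +
        inner ℝ w (P.act i (P.fwPoint orc dbar s i)) ≤
        g * P.h i (y i) + inner ℝ w (P.act i (y i)) :=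
      ho.minimizes i g w (le_max_right _ _) (y i) (hy.1 i)
    have h5 := mul_le_mul_of_nonneg_left h4 (show (0 : ℝ) ≤ 1 / N by positivity)
    simp only [inner_sub_right, inner_smul_right]
    linarith
  -- Convexity bounds the linearization by the merit of the comparison point, whose constraint part
  -- vanishes by feasibility.
  have h6 := sq_max_ge (∑ j, s.1 j - dbar) (v - dbar)
  have h7 := norm_sq_projPos_ge (∑ j, s.2 j - P.b) (zy - P.b)
  rw [projPos_eq_zero (v := zy - P.b) (fun j => sub_nonpos.2 (hy.2 j)), norm_zero] at h7
  rw [sub_sub_sub_cancel_right, ← hg] at h6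
  rw [sub_sub_sub_cancel_right, ← hw] at h7
  have h8 : P.merit dbar s = g ^ 2 + ‖w‖ ^ 2 := rfl
  have h9 : 𝔼 i, (g * (1 / (N : ℝ) * P.h i (P.fwPoint orc dbar s i) - s.1 i) +
        inner ℝ w ((1 / (N : ℝ)) • P.act i (P.fwPoint orc dbar s i) - s.2 i)) ≤
      (max (v - dbar) 0 ^ 2 - P.merit dbar s) / 2 / N := by
    rw [Fintype.expect_eq_sum_div_card, Fintype.card_fin]
    refine div_le_div_of_nonneg_right ?_ hN'.le
    linarith
  have h10 := mul_le_mul_of_nonneg_left h9 hr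
  have h11 : 2 * (r * ((max (v - dbar) 0 ^ 2 - P.merit dbar s) / 2 / N)) =
      r / N * (max (v - dbar) 0 ^ 2 - P.merit dbar s) := by ring
  simp only [Finset.expect_add_distrib, ← Finset.mul_expect] at h10
  linarith

/-- The rate of the second stage, the influence of the starting point decreasing like `1/K²`. -/
lemma IsOracle.expect_merit_bcfw_le [NeZero N] (ho : P.IsOracle orc)
    (hG : ∀ i, ∀ x ∈ P.X i, ‖P.act i x - P.b‖ ≤ G) (hH : ∀ i, ∀ x ∈ P.X i, |P.h i x| ≤ H)
    (hs : P.BlockBound G H s₀) {y : ∀ i, E (d i)} (hy : P.BidualFeasible y) (hK : 1 ≤ K) :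
    𝔼 ω : Fin K → Fin N, P.merit dbar (P.bcfw orc dbar
        (fun k => 2 * (N : ℝ) / ((k : ℝ) + 2 * N)) ω s₀ K) ≤
      max ((1 / (N : ℝ)) * ∑ i, P.h i (y i) - dbar) 0 ^ 2 +
        (2 * N / K) ^ 2 * P.merit dbar s₀ + 4 * (4 * H ^ 2 + 4 * G ^ 2) / K := by
  have hN' : (1 : ℝ) ≤ N := by exact_mod_cast (NeZero.one_le : 1 ≤ N)
  have hK' : (1 : ℝ) ≤ K := by exact_mod_cast hK
  set V := max ((1 / (N : ℝ)) * ∑ i, P.h i (y i) - dbar) 0 ^ 2 with hV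
  set D := 4 * H ^ 2 + 4 * G ^ 2 with hD
  have hD0 : 0 ≤ D := by positivity
  set ρ : ℕ → ℝ := fun k => 2 * (N : ℝ) / ((k : ℝ) + 2 * N) with hρ
  have hρ0 : ∀ k, 0 ≤ ρ k := fun k => by simp only [hρ]; positivity
  have hρ1 : ∀ k, ρ k ≤ 1 := fun k => by
    simp only [hρ]
    exact div_le_one_of_le₀ (by linarith [(Nat.cast_nonneg k : (0 : ℝ) ≤ k)]) (by positivity)
  set e : ℕ → ℝ := fun k => 𝔼 ω : Fin K → Fin N, P.merit dbar (P.bcfw orc dbar ρ ω s₀ k) with he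
  have hstep : ∀ k < K, e (k + 1) ≤ e k + ρ k / N * (V - e k) + ρ k ^ 2 * D / N ^ 2 := by
    intro k hk
    let k₀ : Fin K := ⟨k, hk⟩
    have h1 : e (k + 1) = 𝔼 ω : Fin K → Fin N, 𝔼 i,
        P.merit dbar (P.fwStep orc dbar (ρ k) (P.bcfw orc dbar ρ ω s₀ k) i) := by
      simp only [he]
      rw [← expect_update k₀]
      refine Finset.expect_congr rfl fun ω _ => Finset.expect_congr rfl fun i _ => ?_
      have h2 := bcfw_succ (P := P) (orc := orc) (dbar := dbar) (ρ := ρ) (s₀ := s₀)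
        (Function.update ω k₀ i) k₀
      simp only [k₀] at h2
      rw [h2, Function.update_self, bcfw_update ω k₀ i k le_rfl]
    rw [h1]
    refine (Finset.expect_le_expect fun ω _ => ho.expect_merit_fwStep_le hG hH
      (hs.bcfw ho hG hH hρ0 hρ1 ω k hk.le) (hρ0 k) hy).trans (le_of_eq ?_)
    simp only [Finset.expect_add_distrib, ← Finset.mul_expect, Finset.expect_sub_distrib,
      Fintype.expect_const]
    rfl
  -- With `a = k + 2N` the contraction factor is `(a - 2)/a`. Multiplying by `a (a - 1)` turns it
  -- into the previous weight `(a - 1)(a - 2)`, and each step adds at most `4 D`.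
  have hu : ∀ k ≤ K, ((k : ℝ) + 2 * N - 1) * (k + 2 * N - 2) * (e k - V) ≤
      (2 * N - 1) * (2 * N - 2) * (e 0 - V) + 4 * D * k := by
    intro k
    induction k with
    | zero => simp
    | succ k ih =>
      intro hk
      have ih := ih (by omega)
      have h1 := hstep k (by omega)
      have hk0 : (0 : ℝ) ≤ k := Nat.cast_nonneg k
      push_cast
      set a : ℝ := k + 2 * N with ha
      have ha2 : 2 ≤ a := by linarith
      have ha0 : 0 < a := by linarith
      have h2 : ρ k / N = 2 / a := by
        simp only [hρ, ← ha]
        field_simp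
      have h3 : ρ k ^ 2 * D / N ^ 2 = 4 * D / a ^ 2 := by
        simp only [hρ, ← ha]
        field_simp
        ring
      rw [h2, h3] at h1
      have h4 : e (k + 1) - V ≤ (a - 2) / a * (e k - V) + 4 * D / a ^ 2 := by
        have : (a - 2) / a * (e k - V) = (e k - V) + 2 / a * (V - e k) := by
          field_simp
          ring
        linarith
      have h5 : a * (a - 1) * (e (k + 1) - V) ≤
          a * (a - 1) * ((a - 2) / a * (e k - V) + 4 * D / a ^ 2) :=
        mul_le_mul_of_nonneg_left h4 (mul_nonneg ha0.le (by linarith))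
      have h6 : a * (a - 1) * ((a - 2) / a * (e k - V) + 4 * D / a ^ 2) =
          (a - 1) * (a - 2) * (e k - V) + 4 * D * ((a - 1) / a) := by
        field_simp
      have h7 : 4 * D * ((a - 1) / a) ≤ 4 * D * 1 := by
        refine mul_le_mul_of_nonneg_left ?_ (by positivity)
        rw [div_le_one ha0]
        linarith
      have h8 : ((k : ℝ) + 1 + 2 * N - 1) * (k + 1 + 2 * N - 2) * (e (k + 1) - V) =
          a * (a - 1) * (e (k + 1) - V) := by rw [ha]; ring
      rw [h8]
      linarith
  have hfin := hu K le_rfl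
  have he0 : e 0 = P.merit dbar s₀ := by
    simp only [he, bcfw, Fintype.expect_const]
  have hm0 := merit_nonneg (P := P) dbar s₀
  have hV0 : 0 ≤ V := sq_nonneg _
  have h1 : (2 * N - 1) * (2 * N - 2) * (e 0 - V) ≤ (2 * N) ^ 2 * P.merit dbar s₀ := by
    rw [he0]
    have hc : (0 : ℝ) ≤ (2 * N - 1) * (2 * N - 2) := mul_nonneg (by linarith) (by linarith)
    have h2 : ((2 : ℝ) * N - 1) * (2 * N - 2) ≤ (2 * N) ^ 2 := by nlinarith
    nlinarith [mul_le_mul_of_nonneg_right h2 hm0, mul_nonneg hc hV0]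
  -- Lowering the weight to `K²` is legitimate only for a nonnegative excess; otherwise the bound is
  -- trivial.
  have h2 : (K : ℝ) ^ 2 * (e K - V) ≤ (2 * N) ^ 2 * P.merit dbar s₀ + 4 * D * K := by
    rcases le_total (e K - V) 0 with h | h
    · have : (K : ℝ) ^ 2 * (e K - V) ≤ 0 := mul_nonpos_of_nonneg_of_nonpos (by positivity) h
      have : 0 ≤ (2 * (N : ℝ)) ^ 2 * P.merit dbar s₀ + 4 * D * K := by positivity
      linarith
    · have h3 : (K : ℝ) ^ 2 ≤ (K + 2 * N - 1) * (K + 2 * N - 2) := by nlinarith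
      have := mul_le_mul_of_nonneg_right h3 h
      linarith
  have h3 : e K - V ≤ ((2 * N) ^ 2 * P.merit dbar s₀ + 4 * D * K) / K ^ 2 := by
    rw [le_div_iff₀ (by positivity)]
    linarith
  have h4 : ((2 * N) ^ 2 * P.merit dbar s₀ + 4 * D * K) / K ^ 2 =
      (2 * N / K) ^ 2 * P.merit dbar s₀ + 4 * D / K := by
    field_simp
  change e K ≤ _
  linarith

/-- The expected residual after the second stage. -/
lemma IsDualSolution.expect_sqrt_merit_bcfw_le [NeZero N] {lamStar : E m}
    (hd : P.IsDualSolution lamStar) (ho : P.IsOracle orc)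
    (hG : ∀ i, ∀ x ∈ P.X i, ‖P.act i x - P.b‖ ≤ G) (hH : ∀ i, ∀ x ∈ P.X i, |P.h i x| ≤ H)
    (hs : P.BlockBound G H s₀) (hdbar : dbar ≤ P.dual lamStar) (hK : 1 ≤ K) :
    𝔼 ω : Fin K → Fin N, √(P.merit dbar (P.bcfw orc dbar
        (fun k => 2 * (N : ℝ) / ((k : ℝ) + 2 * N)) ω s₀ K)) ≤
      (P.dual lamStar - dbar) + 2 * N / K * √(P.merit dbar s₀) +
        2 * √(4 * H ^ 2 + 4 * G ^ 2) / √K := by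
  set ρ : ℕ → ℝ := fun k => 2 * (N : ℝ) / ((k : ℝ) + 2 * N) with hρ
  set R := 2 * N / K * √(P.merit dbar s₀) + 2 * √(4 * H ^ 2 + 4 * G ^ 2) / √K with hR
  have hm0 := merit_nonneg (P := P) dbar s₀
  -- Stated as a lower bound for all feasible values `v`, so that the infimum can be taken without
  -- an optimal bidual point.
  have key : (𝔼 ω : Fin K → Fin N, √(P.merit dbar (P.bcfw orc dbar ρ ω s₀ K))) - R + dbar ≤
      P.dual lamStar := by
    rw [le_isGLB_iff hd.strong_duality]
    rintro v ⟨y, hy, hv⟩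
    have hvd : P.dual lamStar ≤ v := hd.strong_duality.1 ⟨y, hy, hv⟩
    have h1 := ho.expect_merit_bcfw_le (dbar := dbar) hG hH hs hy hK
    rw [← hv, max_eq_left (by linarith)] at h1
    have h2 := expect_abs_le_of_expect_sq_le
      (fun ω : Fin K → Fin N => √(P.merit dbar (P.bcfw orc dbar ρ ω s₀ K)))
      (B := (v - dbar) ^ 2 + (2 * N / K) ^ 2 * P.merit dbar s₀ +
        4 * (4 * H ^ 2 + 4 * G ^ 2) / K) (by
        simp only [Real.sq_sqrt (merit_nonneg _ _)]
        exact h1)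
    simp only [abs_of_nonneg (Real.sqrt_nonneg _)] at h2
    -- The root of a sum of three squares of nonnegative numbers is at most their sum.
    have h3 : √((v - dbar) ^ 2 + (2 * N / K) ^ 2 * P.merit dbar s₀ +
        4 * (4 * H ^ 2 + 4 * G ^ 2) / K) ≤ (v - dbar) + R := by
      have hvd0 : 0 ≤ v - dbar := by linarith
      rw [Real.sqrt_le_left (by positivity), hR]
      have h4 : (2 * N / K * √(P.merit dbar s₀)) ^ 2 =
          (2 * N / K) ^ 2 * P.merit dbar s₀ := by
        rw [mul_pow, Real.sq_sqrt hm0]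
      have h5 : (2 * √(4 * H ^ 2 + 4 * G ^ 2) / √K) ^ 2 =
          4 * (4 * H ^ 2 + 4 * G ^ 2) / K := by
        rw [div_pow, mul_pow, Real.sq_sqrt (by positivity), Real.sq_sqrt (by positivity)]
        norm_num
      have hp : 0 ≤ 2 * N / K * √(P.merit dbar s₀) := by positivity
      have hq : 0 ≤ 2 * √(4 * H ^ 2 + 4 * G ^ 2) / √K := by positivity
      rw [← h4, ← h5]
      nlinarith [mul_nonneg hvd0 hp, mul_nonneg hvd0 hq, mul_nonneg hp hq]
    linarith
  linarith

end Stage2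

end Problem

end TwoStage

namespace TwoStage

namespace Problem

variable {N m : ℕ} {d : Fin N → ℕ} {P : Problem N m d} {orc : ∀ i, ℝ → E m → E (d i)}

/-! ### The complete method -/

section Method

variable {G H : ℝ} {T K : ℕ} {lamStar : E m}

/-- The residuals of the two stages control both guarantees, since the reconstruction preserves
`(β^K, z^K)` on average. -/
lemma IsDualSolution.guarantee [NeZero N] (hd : P.IsDualSolution lamStar)
    (ho : P.IsOracle orc) (hP : ∀ i, IsAdmissible (P.f i))
    (hG : ∀ i, ∀ x ∈ P.X i, ‖P.act i x - P.b‖ ≤ G) (hH : ∀ i, ∀ x ∈ P.X i, |P.h i x| ≤ H)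
    (hK : 1 ≤ K) {α : ℝ} {ι : Type} [Fintype ι] {start : (Fin (T - 1) → Fin N) → Start d ι}
    (hs : ∀ ω, P.ValidStart (start ω))
    (M : P.Method orc 0 (fun _ => α) (fun k => 2 * (N : ℝ) / ((k : ℝ) + 2 * N)) T K start)
    {err : ℝ}
    (herr : 𝔼 ω : Fin (T - 1) → Fin N,
        (P.dual lamStar - P.dual (P.lamBar orc 0 (fun _ => α) ω)) +
      2 * N / K * 𝔼 ω : Fin (T - 1) → Fin N,
        √(P.merit (P.dual (P.lamBar orc 0 (fun _ => α) ω))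
          (P.beta0 (start ω), P.z0 (start ω))) +
      2 * √(4 * H ^ 2 + 4 * G ^ 2) / √K ≤ err) :
    M.Guarantee (P.dual lamStar) err := by
  have hbound : 𝔼 ω₁ : Fin (T - 1) → Fin N, 𝔼 ω₂ : Fin K → Fin N,
      √(P.merit (P.dual (P.lamBar orc 0 (fun _ => α) ω₁))
        (P.blocks orc (P.dual (P.lamBar orc 0 (fun _ => α) ω₁))
          (fun k => 2 * (N : ℝ) / ((k : ℝ) + 2 * N)) ω₂ (start ω₁) K)) ≤ err := by
    have hω := Finset.expect_le_expect fun (ω₁ : Fin (T - 1) → Fin N)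
        (_ : ω₁ ∈ Finset.univ) =>
      hd.expect_sqrt_merit_bcfw_le (K := K) (s₀ := (P.beta0 (start ω₁), P.z0 (start ω₁))) ho hG hH
        ⟨(hs ω₁).abs_beta0_le hH, (hs ω₁).norm_z0_sub_le hG⟩
        (hd.isMax (P.lamBar orc 0 (fun _ => α) ω₁) (lamBar_nonneg ω₁)) hK
    refine le_trans hω ?_
    simp only [Finset.expect_add_distrib, Fintype.expect_const, ← Finset.mul_expect]
    exact herr
  constructor
  · have h1 : M.expect (fun x => (1 / (N : ℝ)) * ∑ i, P.val i (x i) - P.dual lamStar) ≤ err := by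
      refine le_trans (Finset.expect_le_expect fun ω₁ _ =>
        Finset.expect_le_expect fun ω₂ _ => ?_) hbound
      rw [Decomposition.expect_val]
      refine le_trans ?_ (sub_le_sqrt_merit _ _)
      -- Measuring from `d̄ ≤ d*` instead of `d*` only increases the residual.
      exact sub_le_sub_left (hd.isMax _ (lamBar_nonneg ω₁)) _
    -- The bound holds without the `γ` term, which is nonnegative and may be added; a block is
    -- needed to see that the supremum is nonnegative.
    have i₀ : Fin N := 0
    have h2 : (0 : EReal) ≤ ⨆ i, gam (P.f i) :=
      (gam_nonneg (hP i₀)).trans (le_iSup (fun i => gam (P.f i)) i₀)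
    have h3 : (0 : EReal) ≤ ((((m : ℝ) + 1) / (N : ℝ) : ℝ) : EReal) :=
      EReal.coe_nonneg.2 (by positivity)
    refine (EReal.coe_le_coe_iff.2 h1).trans ?_
    exact le_add_of_nonneg_left (mul_nonneg h3 h2)
  · intro j
    refine le_trans (Finset.expect_le_expect fun ω₁ _ =>
      Finset.expect_le_expect fun ω₂ _ => ?_) hbound
    rw [Decomposition.expect_act]
    exact apply_le_sqrt_merit _ _ j

end Method

/-! ### Constants -/

/-- Constant in the bound on the duality gap after the first stage. -/
noncomputable def gapConst (Λ G L : ℝ) : ℝ := (L ^ 2 + Λ ^ 2) * G / (2 * Λ)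

/-- Bound on the second moments of the dual iterates. -/
noncomputable def iterConst (Λ L : ℝ) : ℝ := 4 * L ^ 2 + 2 * Λ ^ 2

/-- Constant in the bound on the residual at the averaged starting point. -/
noncomputable def startConst (Λ G H L : ℝ) : ℝ :=
  √(2 * H ^ 2 + 2 * G ^ 2 * iterConst Λ L) + Λ * G / 2 + gapConst Λ G L +
    √(iterConst Λ L) * G / Λ + 2 * (2 * H + G)

/-! ### Explicit rates for the step size `Λ / (G √T)` -/

section Rates

variable {Λ G H L : ℝ} {T : ℕ} {lamStar : E m}

lemma gapConst_nonneg (hΛ : 0 < Λ) (hG : 0 ≤ G) : 0 ≤ gapConst Λ G L := by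
  unfold gapConst
  positivity

lemma startConst_nonneg (hΛ : 0 < Λ) (hG : 0 ≤ G) (hH : 0 ≤ H) : 0 ≤ startConst Λ G H L := by
  have := gapConst_nonneg (L := L) hΛ hG
  unfold startConst
  positivity

/-- The step size involves the exact `G̃`, while the final constant may only involve its upper
bound; monotonicity in `G` bridges the two. -/
lemma gapConst_mono {G' : ℝ} (hΛ : 0 < Λ) (h : G ≤ G') : gapConst Λ G L ≤ gapConst Λ G' L := by
  unfold gapConst
  gcongr

lemma startConst_mono {G' : ℝ} (hΛ : 0 < Λ) (hG : 0 ≤ G) (h : G ≤ G') :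
    startConst Λ G H L ≤ startConst Λ G' H L := by
  have := gapConst_mono (L := L) hΛ h
  have hi : 0 ≤ iterConst Λ L := by unfold iterConst; positivity
  unfold startConst
  gcongr

lemma step_sq_le (G : ℝ) (T : ℕ) : T * ((Λ / (G * √T)) ^ 2 * G ^ 2) ≤ Λ ^ 2 := by
  rcases eq_or_ne G 0 with rfl | hG
  · simp only [ne_eq, OfNat.ofNat_ne_zero, not_false_eq_true, zero_pow, mul_zero]
    positivity
  · rcases Nat.eq_zero_or_pos T with rfl | hT
    · simp only [Nat.cast_zero, zero_mul]
      positivity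
    · have hT' : (0 : ℝ) < T := by exact_mod_cast hT
      rw [div_pow, mul_pow, Real.sq_sqrt hT'.le]
      apply le_of_eq
      field_simp

/-- The step degenerates only through the convention `Λ / 0 = 0`. -/
lemma step_eq_zero (hΛ : 0 < Λ) (hT : 1 ≤ T) (h : Λ / (G * √T) = 0) : G = 0 := by
  have hT' : √(T : ℝ) ≠ 0 := by positivity
  rcases div_eq_zero_iff.1 h with h | h
  · exact absurd h hΛ.ne'
  · exact (mul_eq_zero.1 h).resolve_right hT'

lemma IsDualSolution.expect_gap_le_rate [NeZero N] (hd : P.IsDualSolution lamStar)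
    (ho : P.IsOracle orc) (hG : ∀ i, ∀ x ∈ P.X i, ‖P.act i x - P.b‖ ≤ G) (hG0 : 0 ≤ G)
    (hΛ : 0 < Λ) (hL : ‖lamStar‖ ≤ L) (hT : 1 ≤ T) :
    𝔼 ω : Fin (T - 1) → Fin N,
        (P.dual lamStar - P.dual (P.lamBar orc 0 (fun _ => Λ / (G * √T)) ω)) ≤
      gapConst Λ G L * (1 / √T) := by
  have hT' : (0 : ℝ) < T := by positivity
  have hg : ∀ i lam, ‖P.sgrad orc i lam‖ ≤ G := fun i lam => hG i _ (ho.mem_X i zero_le_one lam)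
  -- For `G = 0` the step is zero, but all supergradients vanish and every multiplier is already
  -- dual optimal.
  rcases hG0.eq_or_lt with h0 | h0
  · have hz : ∀ i lam, P.sgrad orc i lam = 0 := fun i lam =>
      norm_le_zero_iff.1 (h0 ▸ hg i lam)
    refine Finset.expect_le Finset.univ_nonempty fun ω _ => ?_
    have := ho.dual_le NeZero.one_le (P.lamBar orc 0 (fun _ => Λ / (G * √T)) ω) lamStar
    simp only [hz, inner_zero_left, Finset.expect_const_zero, add_zero] at this
    rw [← h0] at this ⊢
    simp only [gapConst, mul_zero, zero_div, zero_mul] at this ⊢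
    linarith
  · have h1 := hd.expect_gap_le (α := Λ / (G * √T)) ho hg (by positivity) hT
    set e := 𝔼 ω : Fin (T - 1) → Fin N,
        (P.dual lamStar - P.dual (P.lamBar orc 0 (fun _ => Λ / (G * √T)) ω))
    have h2 := step_sq_le (Λ := Λ) G T
    have h3 : ‖lamStar‖ ^ 2 ≤ L ^ 2 := pow_le_pow_left₀ (norm_nonneg _) hL 2
    have hsT : (0 : ℝ) < √T := Real.sqrt_pos.2 hT'
    have h4 : 2 * (Λ / (G * √T)) * (T * e) = 2 * Λ * √T / G * e := by
      have : (T : ℝ) = √T * √T := (Real.mul_self_sqrt hT'.le).symm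
      field_simp
      rw [Real.sq_sqrt hT'.le]
    have h5 : 2 * Λ * √T / G * e ≤ L ^ 2 + Λ ^ 2 := by linarith
    have h6 : gapConst Λ G L * (1 / √T) = (L ^ 2 + Λ ^ 2) / (2 * Λ * √T / G) := by
      unfold gapConst
      field_simp
    rw [h6, le_div_iff₀' (by positivity)]
    exact h5

lemma IsDualSolution.expect_sqrt_merit_averagedStart_le [NeZero N]
    (hd : P.IsDualSolution lamStar) (ho : P.IsOracle orc)
    (hG : ∀ i, ∀ x ∈ P.X i, ‖P.act i x - P.b‖ ≤ G) (hG0 : 0 ≤ G)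
    (hH : ∀ i, ∀ x ∈ P.X i, |P.h i x| ≤ H)
    (hΛ : 0 < Λ) (hL : ‖lamStar‖ ≤ L) (hT : 1 ≤ T) :
    𝔼 ω : Fin (T - 1) → Fin N,
        √(P.merit (P.dual (P.lamBar orc 0 (fun _ => Λ / (G * √T)) ω))
          (P.beta0 (P.averagedStart orc 0 (fun _ => Λ / (G * √T)) ω),
            P.z0 (P.averagedStart orc 0 (fun _ => Λ / (G * √T)) ω))) ≤
      startConst Λ G H L * (√((N : ℝ) / T) + N / T) := by
  have hT' : (0 : ℝ) < T := by positivity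
  have hsT : (0 : ℝ) < √T := Real.sqrt_pos.2 hT'
  have hN1 : (1 : ℝ) ≤ N := by exact_mod_cast (NeZero.one_le : 1 ≤ N)
  have hH0 : 0 ≤ H := (abs_nonneg _).trans (hd.abs_dual_le NeZero.one_le hH)
  have hg : ∀ i lam, ‖P.sgrad orc i lam‖ ≤ G := fun i lam => hG i _ (ho.mem_X i zero_le_one lam)
  have hα : 0 ≤ Λ / (G * √T) := by positivity
  have hαG : Λ / (G * √T) = 0 → G = 0 := step_eq_zero hΛ hT
  have hgap := hd.expect_gap_le_rate ho hG hG0 hΛ hL hT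
  have hR : 4 * ‖lamStar‖ ^ 2 + 2 * (T * ((Λ / (G * √T)) ^ 2 * G ^ 2)) ≤ iterConst Λ L := by
    have := step_sq_le (Λ := Λ) G T
    have := pow_le_pow_left₀ (norm_nonneg _) hL 2
    unfold iterConst
    linarith
  have hmart := hd.expect_abs_sum_lag_sub_le (T := T) ho hg hH hα hR
  have hiter := expect_abs_le_of_expect_sq_le
    (fun ω : Fin (T - 1) → Fin N => ‖P.dualIter orc 0 (fun _ => Λ / (G * √T)) ω (T - 1)‖)
    ((hd.expect_norm_sq_le (T := T) ho hg hα (T - 1) le_rfl).trans hR)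
  simp only [abs_norm] at hiter
  have hdev := expect_blockDev_le (N := N) hT
  have h1 := Finset.expect_le_expect fun (ω : Fin (T - 1) → Fin N) (_ : ω ∈ Finset.univ) =>
    hd.sqrt_merit_averagedStart_le ho hT hG hH hα hαG ω
      (hd.isMax _ (lamBar_nonneg (P := P) (orc := orc) (α := Λ / (G * √T)) ω))
  refine h1.trans ?_
  simp only [Finset.expect_add_distrib, Fintype.expect_const, ← Finset.mul_expect,
    ← Finset.expect_div]
  set q := 1 / √(T : ℝ) with hq
  have hq0 : 0 ≤ q := by positivity
  -- All terms of order `1/√T` are absorbed into `√(N/T)`, as `N ≥ 1`.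
  have hqr : q ≤ √((N : ℝ) / T) := by
    rw [hq, ← Real.sqrt_one, ← Real.sqrt_div zero_le_one]
    gcongr
  have hNT : 0 ≤ (N : ℝ) / T := by positivity
  have e1 : √(T * (2 * H ^ 2 + 2 * G ^ 2 * iterConst Λ L)) / T =
      √(2 * H ^ 2 + 2 * G ^ 2 * iterConst Λ L) * q := by
    rw [Real.sqrt_mul hT'.le, hq]
    rw [mul_one_div, div_eq_div_iff hT'.ne' hsT.ne', mul_comm √(T : ℝ), mul_assoc,
      Real.mul_self_sqrt hT'.le]
  have e2 : Λ / (G * √T) * G ^ 2 / 2 = Λ * G / 2 * q := by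
    rcases eq_or_ne G 0 with rfl | hG'
    · simp
    · rw [hq]
      field_simp
  have e3 : √(iterConst Λ L) / (Λ / (G * √T)) / T = √(iterConst Λ L) * G / Λ * q := by
    rw [hq, div_div_eq_mul_div]
    field_simp
    rw [Real.sq_sqrt hT'.le]
  have b1 := div_le_div_of_nonneg_right hmart hT'.le
  rw [e1] at b1
  have b2 := div_le_div_of_nonneg_right (div_le_div_of_nonneg_right hiter hα) hT'.le
  rw [e3] at b2
  have b3 := mul_le_mul_of_nonneg_left hdev (show 0 ≤ 2 * H + G by positivity)
  have hc : 0 ≤ √(2 * H ^ 2 + 2 * G ^ 2 * iterConst Λ L) + Λ * G / 2 + gapConst Λ G L +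
    √(iterConst Λ L) * G / Λ := by
    have := gapConst_nonneg (L := L) hΛ hG0
    positivity
  have b4 := mul_le_mul_of_nonneg_left (hqr.trans (le_add_of_nonneg_right hNT)) hc
  have b5 : (2 * H + G) * (√((N : ℝ) / T) + 2 * (N / T)) ≤
      2 * (2 * H + G) * (√((N : ℝ) / T) + N / T) := by
    have := mul_nonneg (show 0 ≤ 2 * H + G by positivity) (Real.sqrt_nonneg ((N : ℝ) / T))
    linarith
  have e4 : startConst Λ G H L * (√((N : ℝ) / T) + N / T) =
      (√(2 * H ^ 2 + 2 * G ^ 2 * iterConst Λ L) + Λ * G / 2 + gapConst Λ G L +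
        √(iterConst Λ L) * G / Λ) * (√((N : ℝ) / T) + N / T) +
      2 * (2 * H + G) * (√((N : ℝ) / T) + N / T) := by
    unfold startConst
    ring
  rw [e4, e2]
  refine le_trans ?_ (add_le_add_left b4 _)
  linarith

lemma IsDualSolution.expect_sqrt_merit_start_le [NeZero N]
    (hd : P.IsDualSolution lamStar) (ho : P.IsOracle orc)
    (hG : ∀ i, ∀ x ∈ P.X i, ‖P.act i x - P.b‖ ≤ G) (hG0 : 0 ≤ G)
    (hH : ∀ i, ∀ x ∈ P.X i, |P.h i x| ≤ H)
    (hΛ : 0 < Λ) (hL : ‖lamStar‖ ≤ L) (hT : 1 ≤ T) {ι : Type} {s : Start d ι}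
    (hs : P.ValidStart s) :
    𝔼 ω : Fin (T - 1) → Fin N,
        √(P.merit (P.dual (P.lamBar orc 0 (fun _ => Λ / (G * √T)) ω)) (P.beta0 s, P.z0 s)) ≤
      2 * H + G + gapConst Λ G L * (1 / √T) := by
  have h1 := Finset.expect_le_expect fun (ω : Fin (T - 1) → Fin N) (_ : ω ∈ Finset.univ) =>
    hs.sqrt_merit_le NeZero.one_le hG hH (hd.abs_dual_le NeZero.one_le hH)
      (hd.isMax _ (lamBar_nonneg (P := P) (orc := orc) (α := Λ / (G * √T)) ω))
  refine h1.trans ?_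
  rw [Finset.expect_add_distrib, Fintype.expect_const]
  exact add_le_add_right (hd.expect_gap_le_rate ho hG hG0 hΛ hL hT) _

end Rates

end Problem

end TwoStage

/-! ### The main theorem -/

open TwoStage TwoStage.Problem in
theorem mainTheorem8 (Λ Gb Hb Lb : ℝ) (hΛ : 0 < Λ) :
    ∃ (C : ℝ) (C' : ℕ → ℝ),
      ∀ (N m : ℕ) (d : Fin N → ℕ) (P : TwoStage.Problem N m d)
        (orc : ∀ i, ℝ → TwoStage.E m → TwoStage.E (d i)) (lamStar : TwoStage.E m) (T K : ℕ),
        1 ≤ N → 1 ≤ T → 1 ≤ K →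
        (∀ i, TwoStage.IsAdmissible (P.f i)) →
        P.IsOracle orc →
        P.IsDualSolution lamStar →
        P.Gtilde ≤ Gb →
        (∀ i, ∀ x ∈ P.X i, |P.h i x| ≤ Hb) →
        ‖lamStar‖ ≤ Lb →
        -- second stage started from the averages of the oracle outputs of the first stage
        (∀ M : P.Method orc 0 (fun _ => Λ / (P.Gtilde * √(T : ℝ)))
            (fun k => 2 * (N : ℝ) / ((k : ℝ) + 2 * N)) T K
            (fun ω => P.averagedStart orc 0 (fun _ => Λ / (P.Gtilde * √(T : ℝ))) ω),
          M.Guarantee (P.dual lamStar) (C * TwoStage.rate N T K)) ∧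
        -- second stage started from arbitrary points at which `f_i = f_i^{**}`
        (∀ x0 : ∀ i, TwoStage.E (d i),
          (∀ i, x0 i ∈ TwoStage.dom (P.f i) ∧
            P.f i (x0 i) = TwoStage.biconj (P.f i) (x0 i)) →
          ∀ M : P.Method orc 0 (fun _ => Λ / (P.Gtilde * √(T : ℝ)))
              (fun k => 2 * (N : ℝ) / ((k : ℝ) + 2 * N)) T K
              (fun _ => TwoStage.Problem.pointStart x0),
            M.Guarantee (P.dual lamStar) (C' N * TwoStage.rate N T K)) := by
  -- The summands are the constants of the dual gap, of the initial residual with its factor `2N/K`,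
  -- and of the curvature term of stage 2.
  refine ⟨gapConst Λ Gb Lb + 2 * startConst Λ Gb Hb Lb + 2 * √(4 * Hb ^ 2 + 4 * Gb ^ 2),
    fun N => gapConst Λ Gb Lb + 2 * N * (2 * Hb + Gb + gapConst Λ Gb Lb) +
      2 * √(4 * Hb ^ 2 + 4 * Gb ^ 2), ?_⟩
  intro N m d P orc lamStar T K hN hT hK hP ho hd hGb hH hL
  have : NeZero N := ⟨by omega⟩
  have hG := norm_act_sub_le_Gtilde hP
  have hG0 : 0 ≤ P.Gtilde := Gtilde_nonneg
  set G := P.Gtilde with hGdef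
  have hH0 : 0 ≤ Hb := (abs_nonneg _).trans (hd.abs_dual_le hN hH)
  have hT' : (0 : ℝ) < T := by positivity
  have hK' : (1 : ℝ) ≤ K := by exact_mod_cast hK
  have hsK : √(K : ℝ) ≤ K := Real.sqrt_le_iff.2 ⟨by positivity, by nlinarith⟩
  have hKK : 1 / (K : ℝ) ≤ 1 / √(K : ℝ) :=
    one_div_le_one_div_of_le (Real.sqrt_pos.2 (by positivity)) hsK
  have hgap := hd.expect_gap_le_rate ho hG hG0 hΛ hL hT
  have hgc := gapConst_mono (L := Lb) hΛ hGb
  have hgc0 := gapConst_nonneg (L := Lb) hΛ hG0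
  have hD : √(4 * Hb ^ 2 + 4 * G ^ 2) ≤ √(4 * Hb ^ 2 + 4 * Gb ^ 2) := by gcongr
  have hqT : (0 : ℝ) ≤ 1 / √(T : ℝ) := by positivity
  have hqK : (0 : ℝ) ≤ 1 / √(K : ℝ) := by positivity
  have hr : (0 : ℝ) ≤ (N : ℝ) / K * (√((N : ℝ) / T) + (N : ℝ) / T) := by positivity
  have hgap' := hgap.trans (mul_le_mul_of_nonneg_right hgc hqT)
  have hDK : 2 * √(4 * Hb ^ 2 + 4 * G ^ 2) / √K ≤
      2 * √(4 * Hb ^ 2 + 4 * Gb ^ 2) * (1 / √K) := by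
    rw [mul_one_div]
    gcongr
  have hD0 := Real.sqrt_nonneg (4 * Hb ^ 2 + 4 * Gb ^ 2)
  constructor
  · intro M
    refine hd.guarantee ho hP hG hH hK (fun ω => ho.validStart_averagedStart ω) M ?_
    have h1 := hd.expect_sqrt_merit_averagedStart_le ho hG hG0 hH hΛ hL hT
    have hsc := startConst_mono (H := Hb) (L := Lb) hΛ hG0 hGb
    have hsc0 := startConst_nonneg (L := Lb) hΛ hG0 hH0
    have h2 := mul_le_mul_of_nonneg_left h1 (show (0 : ℝ) ≤ 2 * N / K by positivity)
    have h3 : 2 * N / K * (startConst Λ G Hb Lb * (√((N : ℝ) / T) + N / T)) =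
        startConst Λ G Hb Lb * (2 * ((N : ℝ) / K * (√((N : ℝ) / T) + (N : ℝ) / T))) := by ring
    rw [h3] at h2
    have h4 := h2.trans (mul_le_mul_of_nonneg_right hsc (by positivity))
    rw [rate]
    set sc := startConst Λ Gb Hb Lb
    set gc := gapConst Λ Gb Lb
    set Db := √(4 * Hb ^ 2 + 4 * Gb ^ 2)
    set a := 1 / √(T : ℝ)
    set b := 1 / √(K : ℝ)
    set c := (N : ℝ) / K * (√((N : ℝ) / T) + (N : ℝ) / T)
    have hs0 : 0 ≤ sc := hsc0.trans hsc
    have hg0 : 0 ≤ gc := hgc0.trans hgc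
    -- The product of `C` with the rate contains each needed term; `p1`, `p2`, `p3` account for the
    -- surplus cross products.
    have p1 := mul_nonneg hg0 (add_nonneg hqK hr)
    have p2 := mul_nonneg hs0 (add_nonneg hqT hqK)
    have p3 := mul_nonneg hD0 (add_nonneg hqT hr)
    linarith
  · intro x0 hx0 M
    have hs := validStart_pointStart hx0
    refine hd.guarantee ho hP hG hH hK (fun _ => hs) M ?_
    have h1 := hd.expect_sqrt_merit_start_le ho hG hG0 hH hΛ hL hT hs
    have h2 := mul_le_mul_of_nonneg_left h1 (show (0 : ℝ) ≤ 2 * N / K by positivity)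
    -- In the bounded part `1/K` is weakened to `1/√K`; in the part already of order `1/√T` it is
    -- weakened to `1`.
    have h3 : 2 * N / K * (2 * Hb + G + gapConst Λ G Lb * (1 / √T)) ≤
        2 * N * (2 * Hb + Gb) * (1 / √K) + 2 * N * gapConst Λ Gb Lb * (1 / √T) := by
      have h4 : 2 * N / K * (2 * Hb + G + gapConst Λ G Lb * (1 / √T)) =
          2 * N * (2 * Hb + G) * (1 / K) + 2 * N * gapConst Λ G Lb * (1 / √T) * (1 / K) := by ring
      have h5 : 1 / (K : ℝ) ≤ 1 := by
        rw [div_le_one (by linarith)]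
        exact hK'
      have h6 : 0 ≤ 2 * Hb + Gb := by linarith
      have h7 : 0 ≤ gapConst Λ Gb Lb := hgc0.trans hgc
      rw [h4]
      refine add_le_add (by gcongr) ?_
      calc _ ≤ 2 * N * gapConst Λ Gb Lb * (1 / √T) * 1 := by gcongr
        _ = _ := mul_one _
    rw [rate]
    set gc := gapConst Λ Gb Lb
    set Db := √(4 * Hb ^ 2 + 4 * Gb ^ 2)
    set a := 1 / √(T : ℝ)
    set b := 1 / √(K : ℝ)
    set c := (N : ℝ) / K * (√((N : ℝ) / T) + (N : ℝ) / T)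
    have hg0 : 0 ≤ gc := hgc0.trans hgc
    have hN0 : (0 : ℝ) ≤ N := Nat.cast_nonneg N
    have p1 := mul_nonneg hg0 (add_nonneg hqK hr)
    have p2 := mul_nonneg (mul_nonneg hN0 (show 0 ≤ 2 * Hb + Gb by linarith)) (add_nonneg hqT hr)
    have p3 := mul_nonneg hD0 (add_nonneg hqT hr)
    have p4 := mul_nonneg (mul_nonneg hN0 hg0) (add_nonneg hqK hr)
    linarith
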